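/- Let $\mathbb{F}_q$ be a finite field with $q$ elements, $\mathbb{F}_q^{ac}$ an algebraic closure of it, $s\ge 0$ an integer and $t_1,\dots,t_s$ indeterminates. Let $\mathbb{K}_s$ be the field of generalized power series $\sum_{i\in I}c_i\theta^{-i}$ with $I\subset\mathbb{Q}$ well-ordered and $c_i\in\mathbb{F}_q^{ac}(t_1,\dots,t_s)$, endowed with the topology of the valuation $v_\infty$ that sends a nonzero series to the least $i$ with $c_i\ne0$. Let $\tau$ be the endomorphism $\sum_i c_i\theta^{-i}\mapsto\sum_i\tau(c_i)\theta^{-qi}$ of $\mathbb{K}_s$, where on $\mathbb{F}_q^{ac}(t_1,\dots,t_s)$ the map $\tau$ is the field endomorphism that is $c\mapsto c^q$ on $\mathbb{F}_q^{ac}$ and fixes every $t_j$. Let $d_n\in\mathbb{F}_q[\theta]$ be the product of all monic polynomials of degree $n$. View $\mathbb{K}_s$ as an $\mathbb{F}_q(t_1,\dots,t_s)[\theta]$-module by multiplication, and let $C(\mathbb{K}_s)$ be the $\mathbb{F}_q(t_1,\dots,t_s)[\theta]$-module with the same underlying $\mathbb{F}_q(t_1,\dots,t_s)$-vector space, on which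 $\theta$ acts by $C_\theta(f)=\theta f+\tau(f)$. Let $(-\theta)^{\frac1{q-1}}$ be any $(q-1)$-th root of $-\theta$ in $\mathbb{K}_s$. Then the infinite product in $$\widetilde\pi:=-(-\theta)^{\frac{q}{q-1}}\prod_{i\ge1}\bigl(1-\theta^{1-q^i}\bigr)^{-1}\in\mathbb{K}_s$$ converges, where $(-\theta)^{\frac{q}{q-1}}$ is the $q$-th power of the chosen root, the series $\exp_C(f):=\sum_{n\ge0}d_n^{-1}\tau^n(f)$ converges in $\mathbb{K}_s$ for every $f\in\mathbb{K}_s$, and $\exp_C$ gives an exact sequence of $\mathbb{F}_q(t_1,\dots,t_s)[\theta]$-modules $$0\to\widetilde\pi\,\mathbb{F}_q(t_1,\dots,t_s)[\theta]\to\mathbb{K}_s\xrightarrow{\ \exp_C\ }C(\mathbb{K}_s)\to0,$$ whose second arrow is the inclusion. In other words, $\exp_C$ is a surjective homomorphism of $\mathbb{F}_q(t_1,\dots,t_s)[\theta]$-modules with kernel exactly $\widetilde\pi\,\mathbb{F}_q(t_1,\dots,t_s)[\theta]$. -/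

import Mathlib

open Polynomial

namespace Carlitz

universe u

noncomputable section

/-- The field `𝔽_q(t₁, …, t_s)`, where `F = 𝔽_q`. -/
abbrev BaseField (F : Type u) [Field F] (s : ℕ) : Type u :=
  FractionRing (MvPolynomial (Fin s) F)

/-- The field `L = 𝔽_q^ac(t₁, …, t_s)`. -/
abbrev CoeffField (F : Type u) [Field F] (s : ℕ) : Type u :=
  FractionRing (MvPolynomial (Fin s) (AlgebraicClosure F))

/-- The inclusion `𝔽_q(t₁, …, t_s) → 𝔽_q^ac(t₁, …, t_s)` fixing every `t_i`. -/
def baseEmb (F : Type u) [Field F] (s : ℕ) : BaseField F s →+* CoeffField F s :=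
  IsFractionRing.map
    (MvPolynomial.map_injective (σ := Fin s) (algebraMap F (AlgebraicClosure F))
      (algebraMap F (AlgebraicClosure F)).injective)

/-- The field `𝕂_s` of the generalized series `∑_{i ∈ I} c_i θ^{-i}` with `I ⊂ ℚ` well-ordered and
`c_i ∈ 𝔽_q^ac(t₁, …, t_s)`. The coefficient `x.coeff i` of a Hahn series `x` is the one of
`θ^{-i}`. -/
def KK (F : Type u) [Field F] (s : ℕ) : Type u := HahnSeries ℚ (CoeffField F s)

instance (F : Type u) [Field F] (s : ℕ) : Field (KK F s) :=
  inferInstanceAs (Field (HahnSeries ℚ (CoeffField F s)))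

/-- The valuation `v_∞` on `𝕂_s`: the least exponent `i` such that `θ^{-i}` occurs. -/
def vInf (F : Type u) [Field F] (s : ℕ) : AddValuation (KK F s) (WithTop ℚ) :=
  HahnSeries.addVal ℚ (CoeffField F s)

/-- `𝕂_s` as a topological (and uniform) field, for the valuation `v_∞`. -/
instance (F : Type u) [Field F] (s : ℕ) :
    Valued (KK F s) (Multiplicative (WithTop ℚ)ᵒᵈ) :=
  Valued.mk' (AddValuation.toValuation (vInf F s))

/-- The monomial `c θ^{-i}`. -/
def mono (F : Type u) [Field F] (s : ℕ) (i : ℚ) (c : CoeffField F s) : KK F s :=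
  (HahnSeries.single i c : HahnSeries ℚ (CoeffField F s))

/-- The element `θ` of `𝕂_s`. -/
def theta (F : Type u) [Field F] (s : ℕ) : KK F s := mono F s (-1) 1

/-- The inclusion of the constants `𝔽_q^ac(t₁, …, t_s)` in `𝕂_s`. -/
def const (F : Type u) [Field F] (s : ℕ) : CoeffField F s →+* KK F s :=
  (HahnSeries.C : CoeffField F s →+* HahnSeries ℚ (CoeffField F s))

/-- `𝕂_s` as an algebra over `𝔽_q(t₁, …, t_s)`. -/
instance (F : Type u) [Field F] (s : ℕ) : Algebra (BaseField F s) (KK F s) :=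
  ((const F s).comp (baseEmb F s)).toAlgebra

/-- `𝕂_s` as an algebra, in particular as a module, over `𝔽_q(t₁, …, t_s)[θ]`: the variable of the
polynomial ring acts as the multiplication by `θ`. -/
instance (F : Type u) [Field F] (s : ℕ) : Algebra (BaseField F s)[X] (KK F s) :=
  (Polynomial.aeval (R := BaseField F s) (theta F s)).toRingHom.toAlgebra

/-- The `q`-Frobenius of `𝔽_q^ac`, extended to `𝔽_q^ac(t₁, …, t_s)` by fixing every `t_i`. -/
def coeffTwist (F : Type u) [Field F] [Fintype F] (s : ℕ) : CoeffField F s →+* CoeffField F s :=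
  IsFractionRing.map
    (MvPolynomial.map_injective (σ := Fin s)
      (FiniteField.frobeniusAlgHom F (AlgebraicClosure F) :
        AlgebraicClosure F →+* AlgebraicClosure F)
      (RingHom.injective _))

/-- The ring endomorphism of a Hahn series ring given by `∑ c_i θ^{-i} ↦ ∑ φ(c_i) θ^{-i}`. -/
def mapCoeff {L : Type u} [Field L] (φ : L →+* L) : HahnSeries ℚ L →+* HahnSeries ℚ L where
  toFun x := x.map φ
  map_one' := by
    ext i
    by_cases h : i = 0 <;> simp [HahnSeries.coeff_one, h]
  map_zero' := by ext i; simp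
  map_add' x y := by ext i; simp
  map_mul' x y := by
    ext i
    have hx : (x.map φ).support = x.support := by
      ext j; simp
    have hy : (y.map φ).support = y.support := by
      ext j; simp
    simp only [HahnSeries.map_coeff, HahnSeries.coeff_mul, map_sum, map_mul]
    apply Finset.sum_congr
    · ext p
      simp
    · intros; rfl

/-- The ring endomorphism of a Hahn series ring given by `∑ c_i θ^{-i} ↦ ∑ c_i θ^{-m i}`, for an
integer `m > 0`. -/
def scaleExp (L : Type u) [Field L] (m : ℕ) (hm : 0 < m) : HahnSeries ℚ L →+* HahnSeries ℚ L :=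
  HahnSeries.embDomainRingHom (AddMonoidHom.mulLeft (m : ℚ))
    (fun _ _ h => mul_left_cancel₀ (Nat.cast_ne_zero.mpr hm.ne') h)
    (fun _ _ => mul_le_mul_iff_right₀ (Nat.cast_pos.mpr hm))

/-- The ring endomorphism `τ` of `𝕂_s` given by `∑ c_i θ^{-i} ↦ ∑ τ(c_i) θ^{-q i}`, where `τ(c)`
is the image of `c` by the Frobenius of the coefficient field which fixes every `t_i`. -/
def tau (F : Type u) [Field F] [Fintype F] (s : ℕ) : KK F s →+* KK F s :=
  ((mapCoeff (coeffTwist F s)).comp (scaleExp (CoeffField F s) (Fintype.card F) Fintype.card_pos) :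
    HahnSeries ℚ (CoeffField F s) →+* HahnSeries ℚ (CoeffField F s))

theorem coeffTwist_baseEmb (F : Type u) [Field F] [Fintype F] (s : ℕ) (c : BaseField F s) :
    coeffTwist F s (baseEmb F s c) = baseEmb F s c := by
  have h : (coeffTwist F s).comp (baseEmb F s) = baseEmb F s := by
    apply IsLocalization.ringHom_ext (nonZeroDivisors (MvPolynomial (Fin s) F))
    apply MvPolynomial.ringHom_ext
    · intro a
      simp [coeffTwist, baseEmb, IsFractionRing.map]
    · intro i
      simp [coeffTwist, baseEmb, IsFractionRing.map]
  exact RingHom.congr_fun h c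

theorem tau_const (F : Type u) [Field F] [Fintype F] (s : ℕ) (c : CoeffField F s) :
    tau F s (const F s c) = const F s (coeffTwist F s c) := by
  have h1 : scaleExp (CoeffField F s) (Fintype.card F) Fintype.card_pos (HahnSeries.C c) =
      HahnSeries.C c := HahnSeries.embDomainRingHom_C
  have h2 : mapCoeff (coeffTwist F s) (HahnSeries.C c) = HahnSeries.C (coeffTwist F s c) :=
    HahnSeries.map_C c (coeffTwist F s)
  exact (congrArg (mapCoeff (coeffTwist F s)) h1).trans h2

/-- `τ` is `𝔽_q(t₁, …, t_s)`-linear. -/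
def tauLin (F : Type u) [Field F] [Fintype F] (s : ℕ) :
    Module.End (BaseField F s) (KK F s) where
  toFun := tau F s
  map_add' := map_add _
  map_smul' c x := by
    simp only [Algebra.smul_def, map_mul, RingHom.id_apply]
    congr 1
    change tau F s (const F s (baseEmb F s c)) = const F s (baseEmb F s c)
    rw [tau_const, coeffTwist_baseEmb]

/-- The operator `C_θ : f ↦ θ f + τ(f)` of `𝕂_s`. -/
def cTheta (F : Type u) [Field F] [Fintype F] (s : ℕ) : Module.End (BaseField F s) (KK F s) :=
  LinearMap.mulLeft (BaseField F s) (theta F s) + tauLin F s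

/-- The `𝔽_q(t₁, …, t_s)[θ]`-module `C(𝕂_s)`: the `𝔽_q(t₁, …, t_s)`-vector space `𝕂_s`, on which
the variable of the polynomial ring acts as `C_θ`. -/
abbrev CKK (F : Type u) [Field F] [Fintype F] (s : ℕ) : Type u :=
  Module.AEval' (cTheta F s)

/-- The identity map `𝕂_s → C(𝕂_s)`. -/
def toCKK (F : Type u) [Field F] [Fintype F] (s : ℕ) : KK F s ≃ₗ[BaseField F s] CKK F s :=
  Module.AEval'.of (cTheta F s)

/-- The polynomial `d_n ∈ A = 𝔽_q[θ]`, the product of all monic polynomials of degree `n`. -/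
def dPoly (F : Type u) [Field F] (n : ℕ) : F[X] :=
  ∏ᶠ a ∈ {a : F[X] | a.Monic ∧ a.natDegree = n}, a

/-- The inclusion `A = 𝔽_q[θ] → 𝕂_s`. -/
def ofA (F : Type u) [Field F] (s : ℕ) : F[X] →+* KK F s :=
  (algebraMap (BaseField F s)[X] (KK F s)).comp
    (Polynomial.mapRingHom (algebraMap F (BaseField F s)))

/-- The term `d_n⁻¹ τⁿ(f)` of the Carlitz exponential series. -/
def expTerm (F : Type u) [Field F] [Fintype F] (s : ℕ) (f : KK F s) (n : ℕ) : KK F s :=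
  (ofA F s (dPoly F n))⁻¹ * (tau F s)^[n] f

/-- The Carlitz exponential `exp_C(f) = ∑_{n ≥ 0} d_n⁻¹ τⁿ(f)` on `𝕂_s`. -/
def expC (F : Type u) [Field F] [Fintype F] (s : ℕ) (f : KK F s) : KK F s :=
  ∑' n, expTerm F s f n

/-- The factor `(1 - θ^{1 - q^i})⁻¹`, for `i = n + 1`. -/
def periodFactor (F : Type u) [Field F] [Fintype F] (s : ℕ) (n : ℕ) : KK F s :=
  (1 - theta F s ^ (1 - (Fintype.card F : ℤ) ^ (n + 1)))⁻¹

/-- For a root `ρ = (-θ)^{1/(q-1)}`, the period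
`π̃ = -(-θ)^{q/(q-1)} ∏_{i ≥ 1} (1 - θ^{1 - q^i})⁻¹`, where `(-θ)^{q/(q-1)} = ρ^q`. -/
def period (F : Type u) [Field F] [Fintype F] (s : ℕ) (ρ : KK F s) : KK F s :=
  -ρ ^ Fintype.card F * ∏' n, periodFactor F s n

/-- A root `(-θ)^{1/(q-1)}` exists in `𝕂_s`. -/
theorem exists_root (F : Type u) [Field F] [Fintype F] (s : ℕ) :
    ∃ ρ : KK F s, ρ ^ (Fintype.card F - 1) = -theta F s := by
  have hq : 1 < Fintype.card F := Fintype.one_lt_card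
  have hn : Fintype.card F - 1 ≠ 0 := by omega
  obtain ⟨c, hc⟩ := IsAlgClosed.exists_pow_nat_eq (-1 : AlgebraicClosure F)
    (Nat.pos_of_ne_zero hn)
  have hn' : ((Fintype.card F - 1 : ℕ) : ℚ) ≠ 0 := by exact_mod_cast hn
  refine ⟨mono F s (-1 / ((Fintype.card F - 1 : ℕ) : ℚ))
    (algebraMap (AlgebraicClosure F) (CoeffField F s) c), ?_⟩
  have key := HahnSeries.single_pow (-1 / ((Fintype.card F - 1 : ℕ) : ℚ))
    (Fintype.card F - 1) (algebraMap (AlgebraicClosure F) (CoeffField F s) c)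
  refine (show _ = _ from key).trans ?_
  rw [← map_pow, hc, nsmul_eq_mul, mul_div_cancel₀ _ hn', map_neg, map_one]
  exact map_neg (HahnSeries.single.addMonoidHom (R := CoeffField F s) (-1 : ℚ)) 1

end

end Carlitz

/-!
The map `exp_C` is the sum of the series `d_n⁻¹ τⁿ`, and the whole argument rests on valuations:
`τ` multiplies them by `q`, and `d_n = ∏_{k < n} (θ^{q^n} - θ^{q^k})` (`map_dPoly`) has valuation
`-n q^n`, so that the series converges everywhere (`summable_expTerm`). The recursion
`d_{n+1} = (θ^{q^{n+1}} - θ) τ(d_n)` gives `exp_C(θ f) = θ exp_C(f) + τ(exp_C(f))`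
(`expC_theta_mul`), which is the linearity over `𝔽_q(t₁, …, t_s)[θ]`.

On the series with valuation greater than `-q / (q - 1)`, the exponential preserves valuations,
hence is injective (`vInf_expC`), and the logarithm `∑ ℓ_n⁻¹ τⁿ`, with
`ℓ_n = ∏_{i=1}^n (θ - θ^{q^i})`, converges and is a right inverse of it (`expC_tsum_logTerm`). Everything else is deduced from this
by division by `θ`, that is, from the properties of the operator `f ↦ θ f + τ(f)`. As `τ(ρ) = -θ ρ`
(`tau_root`), the substitution `f = ρ h` turns that operator into `θ ρ (1 - τ)`. Now `1 - τ` is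
surjective on `𝕂_s` (`exists_sub_tau`), with kernel `𝔽_q(t₁, …, t_s)`
(`exists_const_eq_of_tau_eq`): for the constant terms this is Artin–Schreier theory in
`𝔽_q^ac`, extended to rational functions thanks to denominators in `𝔽_q[t₁, …, t_s]`; for the other
terms one sums `∑_{n ≥ 0} τⁿ` over the positive exponents and `-∑_{n ≥ 1} τ^{-n}` over the negative
ones.

* Surjectivity: dividing an element by `θ` for the Carlitz action divides very negative valuations
  by `q`, so that finitely many divisions lead to the domain of the logarithm (`expC_surjective`).
* Kernel: the series `log_C(ρ)` telescopes to `ρ ∏ (1 - θ^{1 - q^i})⁻¹`, hence is `π̃ / θ`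
  (`sum_logTerm_root`, `period_eq`). Thus `exp_C(π̃ / θ) = ρ` spans the kernel of `f ↦ θ f + τ(f)`.
  If `exp_C(f) = 0`, then `exp_C(f / θ)` is in that kernel, so it is `b ρ` for a constant `b`, and
  `(f - b π̃) / θ` is again in the kernel of `exp_C`, where the lower bound for the valuation has
  improved by one. An induction ends in the domain where `exp_C` is injective
  (`mem_span_period_of_expC_eq_zero`).
-/

namespace Carlitz

universe u

noncomputable section

/-! ### The coefficient field -/

/-- In a field containing `𝔽_q`, the solutions of `x^q = x` are the elements of `𝔽_q`. -/
theorem mem_range_of_pow_card_eq {F K : Type*} [Field F] [Fintype F] [Field K] (f : F →+* K)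
    {x : K} (hx : x ^ Fintype.card F = x) : ∃ a, f a = x := by
  have hr := FiniteField.roots_X_pow_card_sub_X F
  have h1 : (X : F[X]).degree < (X ^ Fintype.card F : F[X]).degree := by
    rw [degree_X_pow, degree_X]
    exact mod_cast Fintype.one_lt_card
  have hm : (X ^ Fintype.card F - X : F[X]).Monic := by
    rw [Monic, leadingCoeff_sub_of_degree_lt h1, monic_X_pow]
  have hprod : ∏ a : F, (X - C a) = (X ^ Fintype.card F - X : F[X]) := by
    have := prod_multiset_X_sub_C_of_monic_of_roots_card_eq hm (by
      rw [hr, FiniteField.X_pow_card_sub_X_natDegree_eq F Fintype.one_lt_card]; rfl)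
    rwa [hr] at this
  have h2 : ∏ a : F, (x - f a) = 0 := by
    have := congrArg (eval₂ f x) hprod
    rw [eval₂_finsetProd] at this
    simpa [hx] using this
  obtain ⟨a, -, ha⟩ := Finset.prod_eq_zero_iff.mp h2
  exact ⟨a, (sub_eq_zero.mp ha).symm⟩

section

variable (F : Type u) [Field F] [Fintype F] (s : ℕ)

/-- The restriction of `coeffTwist` to polynomials. -/
def polyTwist : MvPolynomial (Fin s) (AlgebraicClosure F) →+*
    MvPolynomial (Fin s) (AlgebraicClosure F) :=
  MvPolynomial.map (FiniteField.frobeniusAlgHom F (AlgebraicClosure F) :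
        AlgebraicClosure F →+* AlgebraicClosure F)

theorem coeffTwist_algebraMap (P : MvPolynomial (Fin s) (AlgebraicClosure F)) :
    coeffTwist F s (algebraMap _ _ P) = algebraMap _ _ (polyTwist F s P) := by
  simp [coeffTwist, IsFractionRing.map, polyTwist]

theorem baseEmb_algebraMap (F : Type u) [Field F] (s : ℕ) (P : MvPolynomial (Fin s) F) :
    baseEmb F s (algebraMap _ _ P) =
      algebraMap _ _ (MvPolynomial.map (algebraMap F (AlgebraicClosure F)) P) := by
  simp [baseEmb, IsFractionRing.map]

theorem polyTwist_surjective : Function.Surjective (polyTwist F s) :=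
  MvPolynomial.map_surjective _
    (Algebra.IsAlgebraic.algHom_bijective
      (FiniteField.frobeniusAlgHom F (AlgebraicClosure F))).surjective

theorem coeffTwist_surjective : Function.Surjective (coeffTwist F s) := by
  intro c
  obtain ⟨a, b, -, rfl⟩ := IsFractionRing.div_surjective
    (A := MvPolynomial (Fin s) (AlgebraicClosure F)) c
  obtain ⟨a, rfl⟩ := polyTwist_surjective F s a
  obtain ⟨b, rfl⟩ := polyTwist_surjective F s b
  exact ⟨algebraMap _ _ a / algebraMap _ _ b, by simp only [map_div₀, coeffTwist_algebraMap]⟩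

/-- The automorphism `τ` of `𝔽_q^ac(t₁, …, t_s)`. -/
def coeffTwistEquiv : CoeffField F s ≃+* CoeffField F s :=
  RingEquiv.ofBijective (coeffTwist F s) ⟨(coeffTwist F s).injective, coeffTwist_surjective F s⟩

theorem coeffTwistEquiv_apply (c : CoeffField F s) :
    coeffTwistEquiv F s c = coeffTwist F s c := rfl

/-- Every element of `𝔽_q^ac(t₁, …, t_s)` has a denominator with coefficients in `𝔽_q`, since
`𝔽_q^ac[t₁, …, t_s]` is algebraic over `𝔽_q[t₁, …, t_s]`. -/
theorem exists_eq_div_baseEmb (F : Type u) [Field F] (s : ℕ) (c : CoeffField F s) :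
    ∃ (P : MvPolynomial (Fin s) (AlgebraicClosure F)) (d : BaseField F s), d ≠ 0 ∧
      c = algebraMap _ _ P / baseEmb F s d := by
  obtain ⟨a, b, hb, rfl⟩ := IsFractionRing.div_surjective
    (A := MvPolynomial (Fin s) (AlgebraicClosure F)) c
  let : Algebra (MvPolynomial (Fin s) F) (MvPolynomial (Fin s) (AlgebraicClosure F)) :=
    MvPolynomial.algebraMvPolynomial
  obtain ⟨r, hr, e, he⟩ := IsAlgebraic.exists_nonzero_dvd
    (Algebra.IsAlgebraic.isAlgebraic (R := MvPolynomial (Fin s) F) b) hb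
  have hmap : MvPolynomial.map (algebraMap F (AlgebraicClosure F)) r = b * e := he
  have hr' : algebraMap (MvPolynomial (Fin s) F) (BaseField F s) r ≠ 0 := by simpa using hr
  refine ⟨a * e, algebraMap _ _ r, hr', ?_⟩
  have hne : baseEmb F s (algebraMap _ _ r) ≠ 0 := by simpa using hr
  have he0 : algebraMap _ (CoeffField F s) e ≠ 0 := by
    intro h
    apply hne
    rw [baseEmb_algebraMap, hmap, map_mul, h, mul_zero]
  rw [baseEmb_algebraMap, hmap, map_mul, map_mul, mul_div_mul_right _ _ he0]

theorem exists_sub_pow_card (a : AlgebraicClosure F) :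
    ∃ x : AlgebraicClosure F, x - x ^ Fintype.card F = a := by
  have h1 : (X : (AlgebraicClosure F)[X]).degree <
      (X ^ Fintype.card F : (AlgebraicClosure F)[X]).degree := by
    rw [degree_X_pow, degree_X]
    exact mod_cast Fintype.one_lt_card
  have h2 : (X ^ Fintype.card F - X + C a : (AlgebraicClosure F)[X]).degree ≠ 0 := by
    rw [degree_add_eq_left_of_degree_lt, degree_sub_eq_left_of_degree_lt h1, degree_X_pow]
    · exact_mod_cast Fintype.card_ne_zero
    · rw [degree_sub_eq_left_of_degree_lt h1, degree_X_pow]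
      refine degree_C_le.trans_lt ?_
      exact_mod_cast Fintype.card_pos
  obtain ⟨x, hx⟩ := IsAlgClosed.exists_root _ h2
  refine ⟨x, ?_⟩
  simp only [IsRoot, eval_add, eval_sub, eval_pow, eval_X, eval_C] at hx
  linear_combination -hx

theorem exists_sub_polyTwist (P : MvPolynomial (Fin s) (AlgebraicClosure F)) :
    ∃ Q, Q - polyTwist F s Q = P := by
  induction P using MvPolynomial.induction_on' with
  | monomial m a =>
    obtain ⟨x, hx⟩ := exists_sub_pow_card F a
    refine ⟨MvPolynomial.monomial m x, ?_⟩
    rw [polyTwist, MvPolynomial.map_monomial, ← map_sub, ← hx]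
    rfl
  | add p q hp hq =>
    obtain ⟨a, rfl⟩ := hp
    obtain ⟨b, rfl⟩ := hq
    exact ⟨a + b, by rw [map_add]; ring⟩

/-- Artin–Schreier equations are solvable in `𝔽_q^ac(t₁, …, t_s)`. -/
theorem exists_sub_coeffTwist (c : CoeffField F s) : ∃ x, x - coeffTwist F s x = c := by
  obtain ⟨P, d, hd, rfl⟩ := exists_eq_div_baseEmb F s c
  obtain ⟨Q, rfl⟩ := exists_sub_polyTwist F s P
  refine ⟨algebraMap _ _ Q / baseEmb F s d, ?_⟩
  rw [map_div₀, coeffTwist_baseEmb, coeffTwist_algebraMap, map_sub, sub_div]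

theorem exists_baseEmb_eq_of_coeffTwist_eq {c : CoeffField F s} (hc : coeffTwist F s c = c) :
    ∃ b, baseEmb F s b = c := by
  obtain ⟨P, d, hd, rfl⟩ := exists_eq_div_baseEmb F s c
  have hd' : baseEmb F s d ≠ 0 := by simpa using hd
  rw [map_div₀, coeffTwist_baseEmb, coeffTwist_algebraMap, div_left_inj' hd'] at hc
  have hP : polyTwist F s P = P := IsFractionRing.injective _ _ hc
  have hmem : P ∈ (MvPolynomial.map (σ := Fin s) (algebraMap F (AlgebraicClosure F))).range := by
    refine MvPolynomial.mem_range_map_iff_coeffs_subset.mpr ?_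
    intro x hx
    obtain ⟨m, -, rfl⟩ := MvPolynomial.mem_coeffs_iff.mp hx
    refine mem_range_of_pow_card_eq (algebraMap F (AlgebraicClosure F)) ?_
    have := congrArg (MvPolynomial.coeff m) hP
    rwa [polyTwist, MvPolynomial.coeff_map] at this
  obtain ⟨R, rfl⟩ := hmem
  exact ⟨algebraMap _ _ R / d, by rw [map_div₀, baseEmb_algebraMap]⟩

end

/-! ### The polynomials `d_n` -/

section

variable {F K : Type*} [Field F] [Fintype F] [Field K]

/-- If `φ : 𝔽_q[θ] → K` is an embedding in a field, then
`φ(d_n) = ∏_{k < n} (θ^{q^n} - θ^{q^k})`. With `v_j = θ^{q^j}`, the divided difference of a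
polynomial `a` of degree at most `n` at `v_0, …, v_n` is its coefficient of degree `n`; as
`a(v_j) = a(θ)^{q^j}`, it is the value at `a(θ)` of the polynomial
`∑_j w_j X^{q^j}`, where `w_j = ∏_{k ≠ j} (v_j - v_k)⁻¹`. That polynomial therefore vanishes at all
`a(θ)` with `deg a < n`, which are `q^n` roots, and takes the value `1` at `θ^n`. -/
theorem map_dPoly (φ : F[X] →+* K) (hφ : Function.Injective φ) (n : ℕ) :
    φ (dPoly F n) = ∏ k ∈ Finset.range n,
      (φ X ^ Fintype.card F ^ n - φ X ^ Fintype.card F ^ k) := by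
  classical
  set q := Fintype.card F with hq
  have hq1 : 1 < q := Fintype.one_lt_card
  let v : ℕ → K := fun j => φ X ^ q ^ j
  have hv : Function.Injective v := by
    intro i j hij
    have h1 : (X : F[X]) ^ q ^ i = X ^ q ^ j := hφ (by simpa [v] using hij)
    have h2 := congrArg natDegree h1
    rw [natDegree_X_pow, natDegree_X_pow] at h2
    exact Nat.pow_right_injective hq1 h2
  have hfrob : ∀ (a : F[X]) (j : ℕ), φ a ^ q ^ j = (a.map (φ.comp C)).eval (v j) := by
    intro a j
    rw [eval_map, ← map_pow]
    have hexp : a ^ q ^ j = expand F (q ^ j) a := by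
      induction j with
      | zero => simp
      | succ j ih => rw [pow_succ, pow_mul, ih, ← FiniteField.expand_card, expand_mul, ← hq,
          ← expand_mul, ← expand_mul, mul_comm]
    have hφ' : ∀ b, φ b = eval₂ (φ.comp C) (φ X) b := fun b => by
      have := hom_eval₂ b C φ X
      rwa [eval₂_C_X] at this
    rw [hexp, hφ', ← eval_map, map_expand, expand_eval, eval_map]
  let w : ℕ → K := fun j => (∏ k ∈ (Finset.range (n + 1)).erase j, (v j - v k))⁻¹
  let G : K[X] := ∑ j ∈ Finset.range (n + 1), C (w j) * X ^ q ^ j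
  have hG : ∀ a : F[X], a.natDegree ≤ n → G.eval (φ a) = φ (C (a.coeff n)) := by
    intro a ha
    have h := Lagrange.coeff_eq_sum (s := Finset.range (n + 1)) (v := v) hv.injOn
      (P := a.map (φ.comp C)) (by
        refine (degree_map_le).trans_lt ?_
        rw [Finset.card_range]
        exact lt_of_le_of_lt (degree_le_of_natDegree_le ha) (by exact_mod_cast n.lt_succ_self))
    rw [Finset.card_range, Nat.add_sub_cancel, coeff_map] at h
    rw [← RingHom.comp_apply, h, eval_finsetSum]
    refine Finset.sum_congr rfl fun j _ => ?_
    rw [eval_mul, eval_C, eval_pow, eval_X, hfrob, div_eq_inv_mul]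
  have hw : (w n)⁻¹ = ∏ k ∈ Finset.range n, (v n - v k) := by
    simp only [w, inv_inv]
    rw [Finset.range_add_one, Finset.erase_insert (by simp)]
  have hwn : w n ≠ 0 := by
    rw [ne_eq, ← inv_eq_zero, hw, ← ne_eq, Finset.prod_ne_zero_iff]
    intro k hk
    exact sub_ne_zero.mpr fun h => (Finset.mem_range.mp hk).ne' (hv h)
  let D := degreeLT F n
  let : Fintype D := Fintype.ofEquiv _ (degreeLTEquiv F n).symm.toEquiv
  have hD : Fintype.card D = q ^ n := by
    rw [Fintype.card_congr (degreeLTEquiv F n).toEquiv]; simp [hq]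
  let H : K[X] := ∏ a : D, (X - C (φ a))
  have hH : H.Monic := monic_prod_of_monic _ _ fun a _ => monic_X_sub_C _
  have hHdeg : H.degree = (q ^ n : ℕ) := by
    rw [degree_prod]; simp [hD]
  have hGlow : (∑ j ∈ Finset.range n, C (w j) * X ^ q ^ j : K[X]).degree < (q ^ n : ℕ) := by
    rw [← mem_degreeLT]
    refine Submodule.sum_mem _ fun j hj => mem_degreeLT.mpr ?_
    refine (degree_C_mul_X_pow_le _ _).trans_lt ?_
    exact_mod_cast Nat.pow_lt_pow_right hq1 (Finset.mem_range.mp hj)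
  have hGtop : (C (w n) * X ^ q ^ n : K[X]).degree = (q ^ n : ℕ) := degree_C_mul_X_pow _ hwn
  have hGs : G = ∑ j ∈ Finset.range n, C (w j) * X ^ q ^ j + C (w n) * X ^ q ^ n :=
    Finset.sum_range_succ _ _
  have hGH : G = C (w n) * H := by
    refine eq_of_degree_sub_lt_of_eval_finset_eq
      (Finset.univ.image fun a : D => φ a) ?_ ?_
    · rw [Finset.card_image_of_injective _ fun a b h => Subtype.ext (hφ h), Finset.card_univ, hD]
      have hGdeg : G.degree = (q ^ n : ℕ) := by
        rw [hGs, degree_add_eq_right_of_degree_lt (by rw [hGtop]; exact hGlow), hGtop]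
      rw [← hGdeg]
      refine degree_sub_lt_left ?_ ?_ ?_
      · rw [hGdeg, degree_C_mul hwn, hHdeg]
      · rw [← degree_ne_bot, hGdeg]; exact WithBot.coe_ne_bot
      · rw [hGs, leadingCoeff_add_of_degree_lt (by rw [hGtop]; exact hGlow),
          leadingCoeff_C_mul_X_pow, leadingCoeff_mul, leadingCoeff_C, hH, mul_one]
    · intro x hx
      obtain ⟨a, -, rfl⟩ := Finset.mem_image.mp hx
      have ha : (a : F[X]).degree < n := mem_degreeLT.mp a.2
      rw [hG _ (natDegree_le_of_degree_le ha.le), coeff_eq_zero_of_degree_lt ha, eval_mul,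
        eval_prod, Finset.prod_eq_zero (Finset.mem_univ a) (by simp)]
      simp
  have hd : dPoly F n = ∏ a : D, (X ^ n - (a : F[X])) := by
    have hset : {a : F[X] | a.Monic ∧ a.natDegree = n} =
        Set.range fun a : D => X ^ n - (a : F[X]) := by
      ext a
      constructor
      · rintro ⟨ha, rfl⟩
        refine ⟨⟨X ^ a.natDegree - a, mem_degreeLT.mpr ?_⟩, by simp⟩
        rw [← degree_X_pow (R := F)]
        refine degree_sub_lt_left ?_ (pow_ne_zero _ X_ne_zero) ?_
        · rw [degree_X_pow, degree_eq_natDegree ha.ne_zero]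
        · rw [ha, monic_X_pow]
      · rintro ⟨a, rfl⟩
        have ha : (a : F[X]).degree < n := mem_degreeLT.mp a.2
        refine ⟨(monic_X_pow n).sub_of_left (by rwa [degree_X_pow]), ?_⟩
        refine natDegree_eq_of_degree_eq_some ?_
        rw [degree_sub_eq_left_of_degree_lt (by rwa [degree_X_pow]), degree_X_pow]
    have hinj : Function.Injective fun a : D => X ^ n - (a : F[X]) := fun a b h =>
      Subtype.ext (sub_right_injective h)
    rw [dPoly, hset, finprod_mem_range hinj, finprod_eq_prod_of_fintype]
  have h1 := hG (X ^ n) (natDegree_X_pow n).le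
  rw [hGH, coeff_X_pow_self, C_1, map_one, eval_mul, eval_C, eval_prod] at h1
  rw [hd, map_prod, ← hw]
  refine eq_inv_of_mul_eq_one_right ?_
  simpa using h1

end

/-! ### The valuation and the topology of `𝕂_s` -/

section

open Filter Topology

variable {F : Type u} [Field F] {s : ℕ}

/-- The coefficient of `θ^{-i}`, as an additive map. -/
def coeffHom (F : Type u) [Field F] (s : ℕ) (i : ℚ) : KK F s →+ CoeffField F s :=
  HahnSeries.coeff.addMonoidHom i

theorem KK.ext {x y : KK F s} (h : ∀ i, coeffHom F s i x = coeffHom F s i y) : x = y :=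
  HahnSeries.ext (funext h)

theorem le_vInf_iff {r : ℚ} {x : KK F s} :
    (r : WithTop ℚ) ≤ vInf F s x ↔ ∀ i < r, coeffHom F s i x = 0 := by
  have h : vInf F s x = HahnSeries.orderTop (x : HahnSeries ℚ (CoeffField F s)) :=
    HahnSeries.addVal_apply
  rw [h]
  refine HahnSeries.le_orderTop_iff_forall.trans ?_
  simp only [WithTop.coe_lt_coe]
  rfl

theorem vInf_eq_top {x : KK F s} : vInf F s x = ⊤ ↔ x = 0 := AddValuation.top_iff _

theorem exists_vInf_eq {x : KK F s} (hx : x ≠ 0) : ∃ r : ℚ, vInf F s x = r :=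
  (WithTop.ne_top_iff_exists.mp (vInf_eq_top.not.mpr hx)).imp fun _ h => h.symm

theorem vInf_mono (i : ℚ) {c : CoeffField F s} (hc : c ≠ 0) : vInf F s (mono F s i c) = i :=
  (HahnSeries.addVal_apply).trans (HahnSeries.orderTop_single hc)

theorem mono_pow (i : ℚ) (c : CoeffField F s) (n : ℕ) :
    mono F s i c ^ n = mono F s (n * i) (c ^ n) := by
  have h := HahnSeries.single_pow i n c
  rw [nsmul_eq_mul] at h
  exact h

theorem ne_zero_of_vInf_eq {x : KK F s} {r : ℚ} (hx : vInf F s x = r) : x ≠ 0 := by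
  rw [ne_eq, ← vInf_eq_top, hx]; exact WithTop.coe_ne_top

theorem vInf_theta : vInf F s (theta F s) = ((-1 : ℚ) : WithTop ℚ) := vInf_mono _ one_ne_zero

theorem theta_ne_zero : theta F s ≠ 0 := ne_zero_of_vInf_eq vInf_theta

theorem vInf_mul {x y : KK F s} {a b : ℚ} (hx : vInf F s x = a) (hy : vInf F s y = b) :
    vInf F s (x * y) = (a + b : ℚ) := by
  rw [AddValuation.map_mul, hx, hy, WithTop.coe_add]

theorem vInf_pow {x : KK F s} {a : ℚ} (hx : vInf F s x = a) (n : ℕ) :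
    vInf F s (x ^ n) = (n * a : ℚ) := by
  induction n with
  | zero => simp
  | succ n ih => rw [pow_succ, vInf_mul ih hx]; congr 1; push_cast; ring

theorem vInf_inv {x : KK F s} {a : ℚ} (hx : vInf F s x = a) :
    vInf F s x⁻¹ = (-a : ℚ) := by
  obtain ⟨b, hb⟩ := exists_vInf_eq (inv_ne_zero (ne_zero_of_vInf_eq hx))
  have h := vInf_mul hx hb
  rw [mul_inv_cancel₀ (ne_zero_of_vInf_eq hx), AddValuation.map_one] at h
  have h' : (0 : ℚ) = a + b := by exact_mod_cast h
  rw [hb, show b = -a by linarith]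

theorem vInf_neg {x : KK F s} : vInf F s (-x) = vInf F s x := AddValuation.map_neg _ _

/-- The closed ball of the series all of whose exponents are at least `r`. -/
def ball (F : Type u) [Field F] (s : ℕ) (r : ℚ) : AddSubgroup (KK F s) where
  carrier := {x | (r : WithTop ℚ) ≤ vInf F s x}
  zero_mem' := by simp
  add_mem' hx hy := by
    rw [Set.mem_ofPred_eq] at *
    exact (le_min hx hy).trans (AddValuation.map_add _ _ _)
  neg_mem' {x} hx := by
    rw [Set.mem_ofPred_eq] at *
    rwa [vInf_neg]

theorem mem_ball {r : ℚ} {x : KK F s} : x ∈ ball F s r ↔ (r : WithTop ℚ) ≤ vInf F s x := by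
  rw [ball, AddSubgroup.mem_mk]
  rfl

theorem mem_ball_iff_coeff {r : ℚ} {x : KK F s} :
    x ∈ ball F s r ↔ ∀ i < r, coeffHom F s i x = 0 :=
  mem_ball.trans le_vInf_iff

theorem mem_ball_iff_le {r a : ℚ} {x : KK F s} (hx : vInf F s x = a) : x ∈ ball F s r ↔ r ≤ a := by
  rw [mem_ball, hx, WithTop.coe_le_coe]

theorem mem_ball_self {a : ℚ} {x : KK F s} (hx : vInf F s x = a) : x ∈ ball F s a :=
  (mem_ball_iff_le hx).mpr le_rfl

theorem ball_anti {r r' : ℚ} (h : r ≤ r') {x : KK F s} (hx : x ∈ ball F s r') : x ∈ ball F s r :=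
  mem_ball.mpr (le_trans (WithTop.coe_le_coe.mpr h) (mem_ball.mp hx))

theorem exists_mem_ball (x : KK F s) : ∃ r, x ∈ ball F s r := by
  rcases eq_or_ne x 0 with rfl | hx
  · exact ⟨0, zero_mem _⟩
  · exact (exists_vInf_eq hx).imp fun _ h => mem_ball_self h

theorem mul_mem_ball {a b : ℚ} {x y : KK F s} (hx : x ∈ ball F s a) (hy : y ∈ ball F s b) :
    x * y ∈ ball F s (a + b) := by
  rw [mem_ball, AddValuation.map_mul, WithTop.coe_add]
  exact add_le_add (mem_ball.mp hx) (mem_ball.mp hy)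

theorem one_mem_ball : (1 : KK F s) ∈ ball F s 0 := by
  rw [mem_ball, AddValuation.map_one]; exact le_rfl

theorem vInf_eq_of_sub_mem_ball {x y : KK F s} {a r : ℚ} (hx : vInf F s x = a) (har : a < r)
    (h : y - x ∈ ball F s r) : vInf F s y = a := by
  have hlt : vInf F s x < vInf F s (y - x) := by
    rw [hx]; exact (WithTop.coe_lt_coe.mpr har).trans_le (mem_ball.mp h)
  rw [← hx, ← AddValuation.map_add_eq_of_lt_left _ hlt, add_sub_cancel]

theorem mem_nhds_zero {S : Set (KK F s)} :
    S ∈ 𝓝 (0 : KK F s) ↔ ∃ r : ℚ, (ball F s r : Set (KK F s)) ⊆ S := by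
  rw [Valued.mem_nhds_zero]
  constructor
  · rintro ⟨γ, hγ⟩
    have hne : (MonoidWithZeroHom.ValueGroup₀.embedding γ.1 :
      Multiplicative (WithTop ℚ)ᵒᵈ) ≠ 0 := by simp
    obtain ⟨r, hr⟩ : ∃ r : ℚ, (MonoidWithZeroHom.ValueGroup₀.embedding γ.1 :
        Multiplicative (WithTop ℚ)ᵒᵈ) = Multiplicative.ofAdd (OrderDual.toDual (r : WithTop ℚ)) :=
      (WithTop.ne_top_iff_exists.mp hne).imp fun _ h => congrArg
          (fun z => Multiplicative.ofAdd (OrderDual.toDual z)) h.symm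
    refine ⟨r + 1, fun x hx => hγ ?_⟩
    change Valuation.restrict _ x < γ.1
    rw [Valuation.restrict_lt_iff_lt_embedding, hr]
    change (r : WithTop ℚ) < vInf F s x
    exact (WithTop.coe_lt_coe.mpr (lt_add_one r)).trans_le (mem_ball.mp hx)
  · rintro ⟨r, hr⟩
    have h0 : (Valued.v : Valuation (KK F s) _).restrict (mono F s r 1) ≠ 0 := by
      rw [ne_eq, map_eq_zero]
      exact ne_zero_of_vInf_eq (vInf_mono r one_ne_zero)
    refine ⟨Units.mk0 _ h0, fun x hx => hr ?_⟩
    have hx' : (Valued.v : Valuation (KK F s) _) x < Valued.v (mono F s r 1) :=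
      (Valuation.restrict_lt_iff _).mp hx
    have hx'' : vInf F s (mono F s r 1) < vInf F s x := hx'
    rw [vInf_mono r one_ne_zero] at hx''
    exact mem_ball.mpr hx''.le

theorem ball_mem_nhds_zero (r : ℚ) : (ball F s r : Set (KK F s)) ∈ 𝓝 (0 : KK F s) :=
  mem_nhds_zero.mpr ⟨r, subset_rfl⟩

theorem isClosed_ball (r : ℚ) : IsClosed (ball F s r : Set (KK F s)) :=
  (ball F s r).isClosed_of_isOpen ((ball F s r).isOpen_of_mem_nhds (ball_mem_nhds_zero r))

theorem tendsto_iff_ball {ι : Type*} {l : Filter ι} {a : ι → KK F s} {x : KK F s} :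
    Tendsto a l (𝓝 x) ↔ ∀ r : ℚ, ∀ᶠ i in l, a i - x ∈ ball F s r := by
  rw [← tendsto_sub_nhds_zero_iff]
  constructor
  · exact fun h r => h (ball_mem_nhds_zero r)
  · intro h S hS
    obtain ⟨r, hr⟩ := mem_nhds_zero.mp hS
    exact (h r).mono fun i hi => hr hi

/-- A set of rational numbers is well-ordered as soon as its initial segments are. -/
theorem isPWO_of_forall_inter_Iic {T : Set ℚ} (h : ∀ r ∈ T, (T ∩ Set.Iic r).IsPWO) : T.IsPWO := by
  rw [Set.isPWO_iff_isWF, Set.isWF_iff_no_descending_seq]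
  intro f hf hmem
  have h0 := (h (f 0) (hmem 0)).isWF
  rw [Set.isWF_iff_no_descending_seq] at h0
  exact h0 f hf fun n => ⟨hmem n, hf.antitone (Nat.zero_le n)⟩

/-- A family whose valuations tend to infinity is summable. -/
theorem summable_of_finite_notMem_ball {ι : Type*} {a : ι → KK F s}
    (h : ∀ r : ℚ, {i | a i ∉ ball F s r}.Finite) : Summable a := by
  classical
  let A : HahnSeries.SummableFamily ℚ (CoeffField F s) ι :=
    { toFun := a
      isPWO_iUnion_support' := by
        refine isPWO_of_forall_inter_Iic fun r _ => ?_
        have : ((h (r + 1)).toFinset : Set ι).Finite := Finset.finite_toSet _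
        refine Set.IsPWO.mono (t := ⋃ i ∈ (h (r + 1)).toFinset, HahnSeries.support (a i)) ?_ ?_
        · exact (Finset.isPWO_bUnion _).mpr fun i _ => HahnSeries.isPWO_support (a i)
        · rintro j ⟨hj, hjr⟩
          obtain ⟨i, hi⟩ := Set.mem_iUnion.mp hj
          refine Set.mem_biUnion (Set.Finite.mem_toFinset _ |>.mpr fun hmem => hi ?_) hi
          exact mem_ball_iff_coeff.mp hmem j (lt_of_le_of_lt hjr (lt_add_one r))
      finite_co_support' := fun g => (h (g + 1)).subset fun i hi hmem => hi
        (mem_ball_iff_coeff.mp hmem g (lt_add_one g)) }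
  let x : KK F s := (HahnSeries.SummableFamily.hsum A : HahnSeries ℚ (CoeffField F s))
  refine ⟨x, ?_⟩
  refine tendsto_iff_ball.mpr fun r => ?_
  filter_upwards [eventually_ge_atTop (h r).toFinset] with t ht
  refine mem_ball_iff_coeff.mpr fun i hi => ?_
  rw [map_sub, map_sum, sub_eq_zero]
  symm
  refine HahnSeries.SummableFamily.coeff_hsum_eq_sum_of_subset (s := A) (g := i) (t := t) ?_
  intro j hj
  refine ht ((h r).mem_toFinset.mpr fun hmem => ?_)
  exact hj (mem_ball_iff_coeff.mp hmem i hi)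

theorem summable_nat_of_mem_ball {a : ℕ → KK F s} {b : ℕ → ℚ} (hb : Tendsto b atTop atTop)
    (h : ∀ n, a n ∈ ball F s (b n)) : Summable a := by
  refine summable_of_finite_notMem_ball fun r => ?_
  obtain ⟨N, hN⟩ := eventually_atTop.mp (hb.eventually_ge_atTop r)
  refine (Set.finite_lt_nat N).subset fun n hn => ?_
  by_contra hlt
  exact hn (ball_anti (hN n (not_lt.mp hlt)) (h n))

theorem tsum_mem_ball {ι : Type*} {a : ι → KK F s} {r : ℚ} (h : ∀ i, a i ∈ ball F s r) :
    ∑' i, a i ∈ ball F s r :=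
  tsum_mem (isClosed_ball r) h

end

/-! ### The endomorphism `τ` of `𝕂_s` -/

section

open Filter Topology

variable {F : Type u} [Field F] [Fintype F] {s : ℕ}

theorem card_pos_rat {F : Type*} [Fintype F] [Field F] : (0 : ℚ) < Fintype.card F := by
  exact_mod_cast Fintype.card_pos

theorem one_lt_card_rat {F : Type*} [Fintype F] [Field F] : (1 : ℚ) < Fintype.card F := by
  exact_mod_cast Fintype.one_lt_card

theorem coeffHom_tau (x : KK F s) (i : ℚ) :
    coeffHom F s i (tau F s x) = coeffTwist F s (coeffHom F s (i / Fintype.card F) x) := by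
  have h : (Fintype.card F : ℚ) * (i / Fintype.card F) = i := mul_div_cancel₀ _ card_pos_rat.ne'
  conv_lhs => rw [← h]
  exact congrArg (coeffTwist F s) (HahnSeries.embDomain_coeff (a := i / Fintype.card F))

theorem tau_mem_ball_iff {x : KK F s} {r : ℚ} :
    tau F s x ∈ ball F s (Fintype.card F * r) ↔ x ∈ ball F s r := by
  simp only [mem_ball_iff_coeff, coeffHom_tau, map_eq_zero]
  constructor
  · intro h i hi
    have := h (Fintype.card F * i) (mul_lt_mul_of_pos_left hi card_pos_rat)
    rwa [mul_div_cancel_left₀ _ card_pos_rat.ne'] at this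
  · intro h i hi
    exact h _ (by rwa [div_lt_iff₀' card_pos_rat])

theorem tau_iterate_mem_ball {x : KK F s} {r : ℚ} (hx : x ∈ ball F s r) (n : ℕ) :
    (tau F s)^[n] x ∈ ball F s (Fintype.card F ^ n * r) := by
  induction n with
  | zero => simpa using hx
  | succ n ih =>
    rw [Function.iterate_succ_apply', pow_succ', mul_assoc]
    exact tau_mem_ball_iff.mpr ih

theorem continuous_tau : Continuous (tau F s) := by
  refine continuous_of_continuousAt_zero (tau F s) ?_
  rw [ContinuousAt, map_zero]
  refine tendsto_iff_ball.mpr fun r => ?_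
  filter_upwards [ball_mem_nhds_zero (r / Fintype.card F)] with x hx
  rw [sub_zero, ← mul_div_cancel₀ r (card_pos_rat (F := F)).ne']
  exact tau_mem_ball_iff.mpr hx

theorem tau_mono (i : ℚ) (c : CoeffField F s) :
    tau F s (mono F s i c) = mono F s (Fintype.card F * i) (coeffTwist F s c) :=
  (congrArg (mapCoeff (coeffTwist F s)) HahnSeries.embDomain_single).trans
    (HahnSeries.map_single (coeffTwist F s : ZeroHom (CoeffField F s) (CoeffField F s)))

theorem tau_theta : tau F s (theta F s) = theta F s ^ Fintype.card F := by
  rw [theta, tau_mono, mono_pow, map_one, one_pow]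

theorem tau_iterate_theta (n : ℕ) :
    (tau F s)^[n] (theta F s) = theta F s ^ Fintype.card F ^ n := by
  induction n with
  | zero => simp
  | succ n ih => rw [Function.iterate_succ_apply', ih, map_pow, tau_theta, ← pow_mul, pow_succ']

/-- For `ρ = (-θ)^{1/(q-1)}`, one has `τ(ρ) = ρ^q`, whence `τ(ρ) = -θ ρ`: the quotient of two
`(q-1)`-th roots of `-θ` is in `𝔽_q`, and one of them is a monomial with coefficient in
`𝔽_q^ac`. -/
theorem tau_root {ρ : KK F s} (hρ : ρ ^ (Fintype.card F - 1) = -theta F s) :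
    tau F s ρ = -theta F s * ρ := by
  have hq : 1 < Fintype.card F := Fintype.one_lt_card
  have hn : Fintype.card F - 1 ≠ 0 := by omega
  obtain ⟨c, hc⟩ := IsAlgClosed.exists_pow_nat_eq (-1 : AlgebraicClosure F)
    (Nat.pos_of_ne_zero hn)
  have hn' : ((Fintype.card F - 1 : ℕ) : ℚ) ≠ 0 := by exact_mod_cast hn
  let e : AlgebraicClosure F →+* CoeffField F s := algebraMap (AlgebraicClosure F) (CoeffField F s)
  have hc0 : e c ≠ 0 := by
    rw [ne_eq, map_eq_zero]
    rintro rfl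
    rw [zero_pow hn] at hc
    exact neg_ne_zero.mpr one_ne_zero hc.symm
  let σ := mono F s (-1 / ((Fintype.card F - 1 : ℕ) : ℚ)) (e c)
  have hσ : σ ^ (Fintype.card F - 1) = -theta F s := by
    rw [mono_pow, ← map_pow, hc, mul_div_cancel₀ _ hn', map_neg, map_one]
    exact map_neg (HahnSeries.single.addMonoidHom (R := CoeffField F s) (-1 : ℚ)) 1
  have hσ0 : σ ≠ 0 := ne_zero_of_vInf_eq (vInf_mono _ hc0)
  have htσ : tau F s σ = σ ^ Fintype.card F := by
    rw [tau_mono, mono_pow]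
    congr 1
    have h1 : e c = algebraMap _ _ (MvPolynomial.C (σ := Fin s) c) :=
      IsScalarTower.algebraMap_apply _ (MvPolynomial (Fin s) (AlgebraicClosure F)) _ c
    rw [h1, coeffTwist_algebraMap, polyTwist, MvPolynomial.map_C, ← map_pow, ← map_pow]
    rfl
  have hz : (ρ / σ) ^ Fintype.card F = ρ / σ := by
    have h1 : (ρ / σ) ^ (Fintype.card F - 1) = 1 := by
      rw [div_pow, hρ, hσ, div_self (neg_ne_zero.mpr theta_ne_zero)]
    rw [← Nat.sub_add_cancel hq.le, pow_succ, h1, one_mul]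
  obtain ⟨a, ha⟩ := mem_range_of_pow_card_eq ((const F s).comp ((baseEmb F s).comp
    (algebraMap F (BaseField F s)))) hz
  have hza : tau F s (ρ / σ) = ρ / σ := by
    rw [← ha]
    simp only [RingHom.comp_apply]
    rw [tau_const, coeffTwist_baseEmb]
  have hρσ : ρ = ρ / σ * σ := (div_mul_cancel₀ ρ hσ0).symm
  rw [hρσ, map_mul, hza, htσ, ← hρσ, ← Nat.sub_add_cancel hq.le, pow_succ, hσ]
  field_simp

end

/-! ### The Carlitz exponential -/

section

open Filter Topology

variable {F : Type u} [Field F] {s : ℕ}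

theorem ofA_X : ofA F s X = theta F s := by
  change aeval (theta F s) (Polynomial.map (algebraMap F (BaseField F s)) X) = theta F s
  rw [Polynomial.map_X, aeval_X]

theorem smul_eq_aeval_mul (p : (BaseField F s)[X]) (f : KK F s) :
    p • f = aeval (theta F s) p * f := rfl

theorem X_smul (f : KK F s) : (X : (BaseField F s)[X]) • f = theta F s * f := by
  rw [smul_eq_aeval_mul, aeval_X]

theorem C_smul (c : BaseField F s) (f : KK F s) : (C c : (BaseField F s)[X]) • f = c • f := by
  rw [smul_eq_aeval_mul, aeval_C, Algebra.smul_def]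

theorem const_mul_mono (c d : CoeffField F s) (i : ℚ) :
    const F s c * mono F s i d = mono F s i (c * d) := by
  have h := HahnSeries.single_mul_single (a := (0 : ℚ)) (b := i) (r := c) (s := d)
  rw [zero_add] at h
  exact h

theorem ofA_injective : Function.Injective (ofA F s) := by
  rw [injective_iff_map_eq_zero]
  intro a ha
  have h1 : ofA F s a = ∑ i ∈ Finset.range (a.natDegree + 1),
      mono F s (-i) (baseEmb F s (algebraMap F _ (a.coeff i))) := by
    conv_lhs => rw [a.as_sum_range_C_mul_X_pow]
    rw [map_sum]
    refine Finset.sum_congr rfl fun i _ => ?_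
    rw [map_mul, map_pow, ofA_X, theta, mono_pow, one_pow]
    have h2 : ofA F s (C (a.coeff i)) =
        const F s (baseEmb F s (algebraMap F _ (a.coeff i))) := by
      change aeval (theta F s) (Polynomial.map (algebraMap F (BaseField F s)) (C _)) = _
      rw [Polynomial.map_C, aeval_C]
      rfl
    rw [h2, const_mul_mono, mul_one]
    congr 1
    ring
  rw [ha] at h1
  ext j
  by_cases hj : j ∈ Finset.range (a.natDegree + 1)
  · have h3 := congrArg (coeffHom F s (-j)) h1
    rw [map_zero, map_sum, Finset.sum_eq_single_of_mem j hj] at h3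
    · have h4 : coeffHom F s (-j) (mono F s (-j) (baseEmb F s (algebraMap F _ (a.coeff j)))) =
        baseEmb F s (algebraMap F _ (a.coeff j)) := HahnSeries.coeff_single_same _ _
      rw [h4] at h3
      simpa using h3.symm
    · intro i _ hij
      refine HahnSeries.coeff_single_of_ne fun h => hij ?_
      exact_mod_cast (neg_injective h).symm
  · rw [coeff_zero]
    exact coeff_eq_zero_of_natDegree_lt (by simpa using hj)

variable [Fintype F]

local notation "q" => Fintype.card F

variable (F s) in
/-- The image `∏_{k < n} (θ^{q^n} - θ^{q^k})` of `d_n` in `𝕂_s`. -/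
def carlitzD (n : ℕ) : KK F s :=
  ∏ k ∈ Finset.range n, (theta F s ^ q ^ n - theta F s ^ q ^ k)

theorem expTerm_eq (f : KK F s) (n : ℕ) :
    expTerm F s f n = (carlitzD F s n)⁻¹ * (tau F s)^[n] f := by
  rw [expTerm, map_dPoly _ ofA_injective, ofA_X, carlitzD]

theorem carlitzD_succ (n : ℕ) :
    carlitzD F s (n + 1) = (theta F s ^ q ^ (n + 1) - theta F s) * tau F s (carlitzD F s n) := by
  rw [carlitzD, Finset.prod_range_succ', pow_zero, pow_one, mul_comm, carlitzD, map_prod]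
  congr 1
  refine Finset.prod_congr rfl fun k _ => ?_
  rw [map_sub, map_pow, map_pow, tau_theta, ← pow_mul, ← pow_mul, ← pow_succ', ← pow_succ']

/-- The leading term of `θ^{q^n} - θ^{q^k}`, for `k < n`, is `θ^{q^n}`. -/
theorem vInf_theta_pow_sub {k n : ℕ} (h : k < n) :
    vInf F s (theta F s ^ q ^ n - theta F s ^ q ^ k) = (-(q : ℚ) ^ n : ℚ) := by
  have hn : vInf F s (theta F s ^ q ^ n) = (-(q : ℚ) ^ n : ℚ) := by
    rw [vInf_pow vInf_theta]; congr 1; push_cast; ring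
  have hk : vInf F s (theta F s ^ q ^ k) = (-(q : ℚ) ^ k : ℚ) := by
    rw [vInf_pow vInf_theta]; congr 1; push_cast; ring
  refine vInf_eq_of_sub_mem_ball hn (neg_lt_neg (pow_lt_pow_right₀ one_lt_card_rat h)) ?_
  rw [sub_sub_cancel_left]
  exact neg_mem (mem_ball_self hk)

theorem vInf_carlitzD (n : ℕ) : vInf F s (carlitzD F s n) = (-(n * (q : ℚ) ^ n) : ℚ) := by
  have h : ∀ m ≤ n, vInf F s (∏ k ∈ Finset.range m, (theta F s ^ q ^ n - theta F s ^ q ^ k)) =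
      (-(m * (q : ℚ) ^ n) : ℚ) := by
    intro m hm
    induction m with
    | zero => simp
    | succ m ih =>
      rw [Finset.prod_range_succ, vInf_mul (ih (by omega)) (vInf_theta_pow_sub (by omega))]
      congr 1
      push_cast
      ring
  exact h n le_rfl

theorem carlitzD_ne_zero (n : ℕ) : carlitzD F s n ≠ 0 := ne_zero_of_vInf_eq (vInf_carlitzD n)

theorem expTerm_mem_ball {f : KK F s} {r : ℚ} (hf : f ∈ ball F s r) (n : ℕ) :
    expTerm F s f n ∈ ball F s ((q : ℚ) ^ n * (n + r)) := by
  rw [expTerm_eq]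
  have h := mul_mem_ball (mem_ball_self (vInf_inv (vInf_carlitzD n))) (tau_iterate_mem_ball hf n)
  rwa [neg_neg, show (n : ℚ) * (q : ℚ) ^ n + (q : ℚ) ^ n * r = (q : ℚ) ^ n * (n + r) by ring] at h

theorem one_le_card_pow (n : ℕ) : (1 : ℚ) ≤ (q : ℚ) ^ n := one_le_pow₀ one_lt_card_rat.le

theorem tendsto_card_pow_mul (r : ℚ) :
    Tendsto (fun n : ℕ => (q : ℚ) ^ n * (n + r)) atTop atTop := by
  have h1 : Tendsto (fun n : ℕ => (n : ℚ) + r) atTop atTop :=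
    tendsto_atTop_add_const_right _ _ tendsto_natCast_atTop_atTop
  refine tendsto_atTop_mono' _ ?_ h1
  filter_upwards [h1.eventually_ge_atTop 0] with n hn
  exact le_mul_of_one_le_left hn (one_le_card_pow n)

theorem summable_expTerm (f : KK F s) : Summable (expTerm F s f) := by
  obtain ⟨r, hr⟩ := exists_mem_ball f
  exact summable_nat_of_mem_ball (tendsto_card_pow_mul r) (expTerm_mem_ball hr)

theorem expC_add (f g : KK F s) : expC F s (f + g) = expC F s f + expC F s g := by
  rw [expC, expC, expC, ← (summable_expTerm f).tsum_add (summable_expTerm g)]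
  refine tsum_congr fun n => ?_
  rw [expTerm, iterate_map_add, mul_add, expTerm, expTerm]

theorem tau_smul (c : BaseField F s) (f : KK F s) : tau F s (c • f) = c • tau F s f :=
  (tauLin F s).map_smul c f

theorem expC_smul (c : BaseField F s) (f : KK F s) : expC F s (c • f) = c • expC F s f := by
  rw [expC, expC, Algebra.smul_def c (∑' n, expTerm F s f n), ← (summable_expTerm f).tsum_mul_left]
  refine tsum_congr fun n => ?_
  have h : (tau F s)^[n] (c • f) = c • (tau F s)^[n] f := by
    induction n with
    | zero => rfl
    | succ n ih => rw [Function.iterate_succ_apply', ih, tau_smul, Function.iterate_succ_apply']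
  rw [expTerm, h, Algebra.smul_def, expTerm, mul_left_comm]

/-- The functional equation of the exponential, a consequence of
`d_{n+1} = (θ^{q^{n+1}} - θ) τ(d_n)`. -/
theorem expC_theta_mul (f : KK F s) :
    expC F s (theta F s * f) = theta F s * expC F s f + tau F s (expC F s f) := by
  have hsum := summable_expTerm f
  have htau : Summable fun n => tau F s (expTerm F s f n) := hsum.map _ continuous_tau
  have h1 : tau F s (expC F s f) = ∑' n, tau F s (expTerm F s f n) :=
    hsum.map_tsum _ continuous_tau
  have hth : Summable fun n => theta F s * expTerm F s f n := hsum.mul_left _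
  have hsuc : ∀ n, expTerm F s (theta F s * f) (n + 1) =
      theta F s * expTerm F s f (n + 1) + tau F s (expTerm F s f n) := by
    intro n
    have hne : theta F s ^ q ^ (n + 1) - theta F s ≠ 0 := by
      have h := ne_zero_of_vInf_eq (vInf_theta_pow_sub (F := F) (s := s) (Nat.succ_pos n))
      rwa [pow_zero, pow_one] at h
    have hne' : tau F s (carlitzD F s n) ≠ 0 := (_root_.map_ne_zero _).mpr (carlitzD_ne_zero n)
    rw [expTerm_eq, expTerm_eq, expTerm_eq, iterate_map_mul, tau_iterate_theta, map_mul,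
      map_inv₀, ← Function.iterate_succ_apply' (tau F s), carlitzD_succ]
    field_simp
    ring
  have h0 : expTerm F s (theta F s * f) 0 = theta F s * expTerm F s f 0 := by
    simp [expTerm_eq, carlitzD]
  rw [h1, expC, expC, (summable_expTerm _).tsum_eq_zero_add, ← hsum.tsum_mul_left,
    hth.tsum_eq_zero_add, h0, add_assoc,
    ← ((summable_nat_add_iff 1).mpr hth).tsum_add htau]
  exact congrArg _ (tsum_congr hsuc)

/-- The exponential, as a morphism of `𝔽_q(t₁, …, t_s)[θ]`-modules. -/
def expLin (F : Type u) [Field F] [Fintype F] (s : ℕ) :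
    KK F s →ₗ[(BaseField F s)[X]] CKK F s where
  toFun f := toCKK F s (expC F s f)
  map_add' f g := by rw [expC_add, map_add]
  map_smul' p f := by
    rw [RingHom.id_apply]
    induction p using Polynomial.induction_on' with
    | add p p' hp hp' => rw [add_smul, expC_add, map_add, hp, hp', add_smul]
    | monomial n c =>
      induction n with
      | zero =>
        rw [monomial_zero_left, C_smul, expC_smul, map_smul, Module.AEval.C_smul]
      | succ n ih =>
        have h : monomial (n + 1) c = X * monomial n c := (X_mul_monomial n c).symm
        rw [h, mul_smul, X_smul, expC_theta_mul, mul_smul, ← ih]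
        exact (Module.AEval'.X_smul_of (cTheta F s) _).symm

theorem expLin_apply (f : KK F s) : expLin F s f = toCKK F s (expC F s f) := rfl

end

/-! ### The Carlitz logarithm -/

section

open Filter Topology

variable {F : Type u} [Field F] {s : ℕ} [Fintype F]

local notation "q" => Fintype.card F

variable (F) in
/-- The exponent `q / (q - 1)`: the exponential is an isometry, with inverse the logarithm, on the
series with valuation greater than `-q / (q - 1)`. -/
def convExp : ℚ := q / ((q : ℚ) - 1)

local notation "β" => convExp F

theorem card_mul_convExp : (q : ℚ) * β - β = q := by
  have h : (q : ℚ) - 1 ≠ 0 := (sub_pos.mpr one_lt_card_rat).ne'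
  rw [convExp]
  field_simp

theorem one_lt_convExp : 1 < β := by
  rw [convExp, one_lt_div (sub_pos.mpr one_lt_card_rat)]
  linarith

theorem convExp_le_two : β ≤ 2 := by
  have h : (2 : ℚ) ≤ q := by exact_mod_cast (Fintype.one_lt_card (α := F))
  rw [convExp, div_le_iff₀ (by linarith)]
  linarith

/-- The exponential preserves the valuation of the series with valuation greater than
`-q / (q - 1)`. -/
theorem vInf_expC {f : KK F s} {r : ℚ} (hf : vInf F s f = r) (hr : -β < r) :
    vInf F s (expC F s f) = r := by
  have hβ := card_mul_convExp (F := F)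
  have h2 := convExp_le_two (F := F)
  have h1 := one_lt_card_rat (F := F)
  have hlt : r < min ((q : ℚ) * (1 + r)) (r + 2) := by
    refine lt_min ?_ (by linarith)
    nlinarith
  refine vInf_eq_of_sub_mem_ball hf hlt ?_
  have h0 : expTerm F s f 0 = f := by simp [expTerm_eq, carlitzD]
  rw [expC, (summable_expTerm f).tsum_eq_zero_add, h0, add_sub_cancel_left]
  refine tsum_mem_ball fun n => ball_anti ?_ (expTerm_mem_ball (mem_ball_self hf) (n + 1))
  rcases n with _ | n
  · refine (min_le_left _ _).trans ?_
    simp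
  · refine (min_le_right _ _).trans ?_
    have h3 : (0 : ℚ) ≤ n := n.cast_nonneg
    push_cast
    refine le_trans ?_ (le_mul_of_one_le_left (by linarith) (one_le_card_pow _))
    linarith

theorem eq_zero_of_expC_eq_zero {f : KK F s} {r : ℚ} (hf : f ∈ ball F s r) (hr : -β < r)
    (h : expC F s f = 0) : f = 0 := by
  by_contra hne
  obtain ⟨a, ha⟩ := exists_vInf_eq hne
  exact ne_zero_of_vInf_eq (vInf_expC ha (hr.trans_le ((mem_ball_iff_le ha).mp hf))) h

variable (F s) in
/-- The product `∏_{i = 1}^n (θ - θ^{q^i})`. -/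
def carlitzL (n : ℕ) : KK F s :=
  ∏ i ∈ Finset.range n, (theta F s - theta F s ^ q ^ (i + 1))

theorem vInf_theta_sub (n : ℕ) :
    vInf F s (theta F s - theta F s ^ q ^ (n + 1)) = (-(q : ℚ) ^ (n + 1) : ℚ) := by
  have h := vInf_theta_pow_sub (F := F) (s := s) n.succ_pos
  rwa [pow_zero, pow_one, ← vInf_neg, neg_sub] at h

theorem vInf_carlitzL (n : ℕ) : vInf F s (carlitzL F s n) = (-(β * (q ^ n - 1)) : ℚ) := by
  induction n with
  | zero => simp [carlitzL]
  | succ n ih =>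
    rw [carlitzL, Finset.prod_range_succ, ← carlitzL, vInf_mul ih (vInf_theta_sub n)]
    congr 1
    linear_combination (q : ℚ) ^ n * card_mul_convExp (F := F)

/-- The term `ℓ_n⁻¹ τⁿ(f)` of the Carlitz logarithm. -/
def logTerm (f : KK F s) (n : ℕ) : KK F s := (carlitzL F s n)⁻¹ * (tau F s)^[n] f

theorem logTerm_mem_ball {f : KK F s} {r : ℚ} (hf : f ∈ ball F s r) (n : ℕ) :
    logTerm f n ∈ ball F s ((q : ℚ) ^ n * (r + β) - β) := by
  have h := mul_mem_ball (mem_ball_self (vInf_inv (vInf_carlitzL n))) (tau_iterate_mem_ball hf n)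
  refine ball_anti (le_of_eq ?_) h
  ring

theorem cast_le_card_pow (n : ℕ) : (n : ℚ) ≤ (q : ℚ) ^ n := by
  exact_mod_cast (Nat.lt_pow_self (Fintype.one_lt_card (α := F))).le

theorem summable_logTerm {f : KK F s} {r : ℚ} (hf : f ∈ ball F s r) (hr : -β < r) :
    Summable (logTerm f) := by
  refine summable_nat_of_mem_ball ?_ (logTerm_mem_ball hf)
  refine tendsto_atTop_mono (f := fun n : ℕ => (n : ℚ) * (r + β) + -β) (fun n => ?_) ?_
  · have := mul_le_mul_of_nonneg_right (cast_le_card_pow (F := F) n)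
      (show 0 ≤ r + β by linarith)
    linarith
  · exact tendsto_atTop_add_const_right _ _
      (tendsto_natCast_atTop_atTop.atTop_mul_const (by linarith))

/-- The coefficient of `τⁿ` in the formal composition of the exponential and the logarithm. -/
def expLogCoeff (F : Type u) [Field F] [Fintype F] (s : ℕ) (n : ℕ) : KK F s :=
  ∑ p ∈ Finset.HasAntidiagonal.antidiagonal n,
    (carlitzD F s p.1)⁻¹ * (tau F s)^[p.1] (carlitzL F s p.2)⁻¹

theorem theta_sub_ne_zero (n : ℕ) : theta F s - theta F s ^ q ^ (n + 1) ≠ 0 :=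
  ne_zero_of_vInf_eq (vInf_theta_sub n)

/-- The recursions of `carlitzD` and `carlitzL` absorb the two halves of
`θ^{q^{i+j}} - θ = (θ^{q^i} - θ) - (θ^{q^i} - θ^{q^{i+j}})`. -/
theorem expLogCoeff_succ (n : ℕ) :
    (theta F s ^ q ^ (n + 1) - theta F s) * expLogCoeff F s (n + 1) =
      tau F s (expLogCoeff F s n) - expLogCoeff F s n := by
  have hD : ∀ i, (theta F s ^ q ^ (i + 1) - theta F s) * (carlitzD F s (i + 1))⁻¹ =
      tau F s (carlitzD F s i)⁻¹ := by
    intro i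
    have h : theta F s ^ q ^ (i + 1) - theta F s ≠ 0 := by
      rw [← neg_ne_zero, neg_sub]; exact theta_sub_ne_zero i
    rw [carlitzD_succ, mul_inv, mul_inv_cancel_left₀ h, map_inv₀]
  have hL : ∀ i j, (theta F s ^ q ^ i - theta F s ^ q ^ (i + j + 1)) *
      (tau F s)^[i] (carlitzL F s (j + 1))⁻¹ = (tau F s)^[i] (carlitzL F s j)⁻¹ := by
    intro i j
    have h1 : theta F s ^ q ^ i - theta F s ^ q ^ (i + j + 1) =
        (tau F s)^[i] (theta F s - theta F s ^ q ^ (j + 1)) := by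
      rw [iterate_map_sub, iterate_map_pow, tau_iterate_theta, ← pow_mul, ← pow_add, add_assoc]
    rw [h1, ← iterate_map_mul, carlitzL, Finset.prod_range_succ, mul_inv,
      mul_comm (∏ i ∈ Finset.range j, _)⁻¹, mul_inv_cancel_left₀ (theta_sub_ne_zero j), carlitzL]
  have hsplit : (theta F s ^ q ^ (n + 1) - theta F s) * expLogCoeff F s (n + 1) =
      ∑ p ∈ Finset.HasAntidiagonal.antidiagonal (n + 1),
        (theta F s ^ q ^ p.1 - theta F s) *
        ((carlitzD F s p.1)⁻¹ * (tau F s)^[p.1] (carlitzL F s p.2)⁻¹) -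
      ∑ p ∈ Finset.HasAntidiagonal.antidiagonal (n + 1),
        (theta F s ^ q ^ p.1 - theta F s ^ q ^ (p.1 + p.2)) *
        ((carlitzD F s p.1)⁻¹ * (tau F s)^[p.1] (carlitzL F s p.2)⁻¹) := by
    rw [expLogCoeff, Finset.mul_sum, ← Finset.sum_sub_distrib]
    refine Finset.sum_congr rfl fun p hp => ?_
    rw [Finset.HasAntidiagonal.mem_antidiagonal.mp hp]
    ring
  rw [hsplit, Finset.Nat.sum_antidiagonal_succ, Finset.Nat.sum_antidiagonal_succ']
  simp only [pow_zero, pow_one, sub_self, zero_mul, zero_add, add_zero]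
  congr 1
  · rw [expLogCoeff, map_sum]
    refine Finset.sum_congr rfl fun p _ => ?_
    rw [← mul_assoc, hD, map_mul, Function.iterate_succ_apply']
  · rw [expLogCoeff]
    refine Finset.sum_congr rfl fun p _ => ?_
    rw [mul_left_comm, ← add_assoc, hL]

theorem expLogCoeff_zero : expLogCoeff F s 0 = 1 := by
  simp [expLogCoeff, carlitzD, carlitzL]

/-- The exponential and the logarithm are formally inverse of each other. -/
theorem expLogCoeff_add_one (n : ℕ) : expLogCoeff F s (n + 1) = 0 := by
  have hne : theta F s ^ q ^ (n + 1) - theta F s ≠ 0 := by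
    rw [← neg_ne_zero, neg_sub]; exact theta_sub_ne_zero n
  have h := expLogCoeff_succ (F := F) (s := s) n
  have h0 : tau F s (expLogCoeff F s n) - expLogCoeff F s n = 0 := by
    induction n with
    | zero => rw [expLogCoeff_zero, map_one, sub_self]
    | succ n ih =>
      have hne' : theta F s ^ q ^ (n + 1) - theta F s ≠ 0 := by
        rw [← neg_ne_zero, neg_sub]; exact theta_sub_ne_zero n
      have h' := expLogCoeff_succ (F := F) (s := s) n
      rw [ih hne' h', mul_eq_zero, or_iff_right hne'] at h'
      rw [h', map_zero, sub_zero]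
  rw [h0, mul_eq_zero, or_iff_right hne] at h
  exact h

/-- The logarithm converges and is a right inverse of the exponential on the series with valuation
greater than `-q / (q - 1)`. -/
theorem expC_tsum_logTerm {f : KK F s} {r : ℚ} (hf : f ∈ ball F s r) (hr : -β < r) :
    expC F s (∑' n, logTerm f n) = f := by
  -- the double series is summed by rows, then by antidiagonals
  let u : ℕ × ℕ → KK F s := fun p => expTerm F s (logTerm f p.2) p.1
  have hε : 0 < r + β := by linarith
  have hball : ∀ p : ℕ × ℕ, u p ∈ ball F s ((q : ℚ) ^ p.1 *
      (p.1 + ((q : ℚ) ^ p.2 * (r + β) - β))) := fun p =>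
    expTerm_mem_ball (logTerm_mem_ball hf p.2) p.1
  have hsum : Summable u := by
    refine summable_of_finite_notMem_ball fun R => ?_
    obtain ⟨N, hN⟩ := exists_nat_gt (max R 0 + β)
    obtain ⟨M, hM⟩ := exists_nat_gt ((max R 0 + β) / (r + β))
    refine (Finset.range N ×ˢ Finset.range M).finite_toSet.subset fun p hp => ?_
    have h0 : (0 : ℚ) ≤ p.1 := p.1.cast_nonneg
    have h1 : (p.2 : ℚ) * (r + β) ≤ (q : ℚ) ^ p.2 * (r + β) :=
      mul_le_mul_of_nonneg_right (cast_le_card_pow p.2) hε.le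
    have h2 : (0 : ℚ) ≤ p.2 * (r + β) := mul_nonneg p.2.cast_nonneg hε.le
    have hlt : p.1 + ((q : ℚ) ^ p.2 * (r + β) - β) < max R 0 := by
      by_contra hge
      rw [not_lt] at hge
      refine hp (ball_anti ?_ (hball p))
      exact (le_max_left R 0).trans
        (hge.trans (le_mul_of_one_le_left ((le_max_right R 0).trans hge) (one_le_card_pow _)))
    rw [Finset.mem_coe, Finset.mem_product, Finset.mem_range, Finset.mem_range]
    constructor
    · have : (p.1 : ℚ) < N := by linarith
      exact_mod_cast this
    · have : (p.2 : ℚ) < M := by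
        refine lt_trans ?_ hM
        rw [lt_div_iff₀ hε]
        linarith
      exact_mod_cast this
  have hlog := summable_logTerm hf hr
  have hrow : ∀ i, HasSum (fun j => u (i, j)) (expTerm F s (∑' n, logTerm f n) i) := by
    intro i
    have h := hlog.hasSum.map ((tau F s) ^ i : KK F s →+* KK F s)
      (by rw [RingHom.coe_pow]; exact continuous_tau.iterate i)
    have h' := h.mul_left (ofA F s (dPoly F i))⁻¹
    rw [RingHom.coe_pow] at h'
    exact h'
  have h1 : HasSum u (expC F s (∑' n, logTerm f n)) := by
    have h := hsum.hasSum.prod_fiberwise hrow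
    rw [expC, h.tsum_eq]
    exact hsum.hasSum
  have hdiag : ∀ n, ∑ p ∈ Finset.HasAntidiagonal.antidiagonal n, u p =
      expLogCoeff F s n * (tau F s)^[n] f := by
    intro n
    rw [expLogCoeff, Finset.sum_mul]
    refine Finset.sum_congr rfl fun p hp => ?_
    change expTerm F s (logTerm f p.2) p.1 = _
    rw [expTerm_eq, logTerm, iterate_map_mul, ← Function.iterate_add_apply,
      Finset.HasAntidiagonal.mem_antidiagonal.mp hp, mul_assoc]
  have h2 : HasSum (fun n => ∑ p ∈ Finset.HasAntidiagonal.antidiagonal n, u p)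
      (expC F s (∑' n, logTerm f n)) := by
    have h := (Finset.HasAntidiagonal.sigmaAntidiagonalEquivProd (A := ℕ)).hasSum_iff.mpr h1
    refine h.sigma fun n => ?_
    rw [← Finset.sum_coe_sort]
    exact hasSum_fintype _
  refine h2.unique ?_
  have h3 := hasSum_single (f := fun n => ∑ p ∈ Finset.HasAntidiagonal.antidiagonal n, u p) 0
    (fun n hn => by
      obtain ⟨m, rfl⟩ := Nat.exists_eq_succ_of_ne_zero hn
      rw [hdiag, expLogCoeff_add_one, zero_mul])
  rwa [hdiag, expLogCoeff_zero, one_mul] at h3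

end

/-! ### The period -/

section

open Filter Topology

variable {F : Type u} [Field F] {s : ℕ} [Fintype F]

local notation "q" => Fintype.card F

local notation "β" => convExp F

theorem periodFactor_eq (n : ℕ) : periodFactor F s n =
    (1 - theta F s / theta F s ^ q ^ (n + 1))⁻¹ := by
  rw [periodFactor, zpow_sub₀ theta_ne_zero, zpow_one, ← Nat.cast_pow, zpow_natCast]

theorem vInf_theta_div (n : ℕ) :
    vInf F s (theta F s / theta F s ^ q ^ (n + 1)) = ((q : ℚ) ^ (n + 1) - 1 : ℚ) := by
  rw [div_eq_mul_inv, vInf_mul vInf_theta (vInf_inv (vInf_pow vInf_theta _))]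
  congr 1
  push_cast
  ring

theorem one_lt_card_pow_succ (n : ℕ) : (1 : ℚ) < (q : ℚ) ^ (n + 1) :=
  one_lt_pow₀ one_lt_card_rat n.succ_ne_zero

theorem vInf_one_sub_theta_div (n : ℕ) :
    vInf F s (1 - theta F s / theta F s ^ q ^ (n + 1)) = ((0 : ℚ) : WithTop ℚ) := by
  refine vInf_eq_of_sub_mem_ball (x := 1) (AddValuation.map_one _)
    (sub_pos.mpr (one_lt_card_pow_succ (F := F) n)) ?_
  rw [sub_sub_cancel_left]
  exact neg_mem (mem_ball_self (vInf_theta_div n))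

theorem one_sub_theta_div_ne_zero (n : ℕ) : 1 - theta F s / theta F s ^ q ^ (n + 1) ≠ 0 :=
  ne_zero_of_vInf_eq (vInf_one_sub_theta_div n)

theorem periodFactor_sub_one_mem_ball (n : ℕ) :
    periodFactor F s n - 1 ∈ ball F s ((q : ℚ) ^ (n + 1) - 1) := by
  have h : periodFactor F s n - 1 =
      theta F s / theta F s ^ q ^ (n + 1) * (1 - theta F s / theta F s ^ q ^ (n + 1))⁻¹ := by
    rw [periodFactor_eq]
    field [one_sub_theta_div_ne_zero (F := F) (s := s) n]
  rw [h]
  have h1 := mul_mem_ball (mem_ball_self (vInf_theta_div (F := F) (s := s) n))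
    (mem_ball_self (vInf_inv (vInf_one_sub_theta_div n)))
  rwa [neg_zero, add_zero] at h1

theorem prod_periodFactor_sub_one_mem_ball {t : Finset ℕ} {N : ℕ} (ht : ∀ i ∈ t, N ≤ i) :
    ∏ i ∈ t, periodFactor F s i - 1 ∈ ball F s ((q : ℚ) ^ (N + 1) - 1) := by
  classical
  have h0 : (0 : ℚ) ≤ (q : ℚ) ^ (N + 1) - 1 := (sub_pos.mpr (one_lt_card_pow_succ N)).le
  induction t using Finset.induction_on with
  | empty => simp
  | insert i t hi ih =>
    rw [Finset.prod_insert hi]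
    have h1 := ih fun j hj => ht j (Finset.mem_insert_of_mem hj)
    have h2 : periodFactor F s i - 1 ∈ ball F s ((q : ℚ) ^ (N + 1) - 1) := by
      refine ball_anti (sub_le_sub_right ?_ _) (periodFactor_sub_one_mem_ball i)
      exact pow_le_pow_right₀ one_lt_card_rat.le
        (Nat.succ_le_succ (ht i (Finset.mem_insert_self i t)))
    have h3 : periodFactor F s i ∈ ball F s 0 := by
      have := add_mem (ball_anti h0 h2) one_mem_ball
      rwa [sub_add_cancel] at this
    have h4 := mul_mem_ball h3 h1
    rw [zero_add] at h4
    have := add_mem h4 h2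
    rwa [show periodFactor F s i * (∏ i ∈ t, periodFactor F s i - 1) + (periodFactor F s i - 1) =
      periodFactor F s i * ∏ i ∈ t, periodFactor F s i - 1 by ring] at this

/-- The partial products of the period determine its unconditional convergence. -/
theorem hasProd_periodFactor {P : KK F s}
    (h : Tendsto (fun n => ∏ i ∈ Finset.range n, periodFactor F s i) atTop (𝓝 P)) :
    HasProd (periodFactor F s) P := by
  classical
  refine tendsto_iff_ball.mpr fun r => ?_
  have hq : Tendsto (fun n : ℕ => (q : ℚ) ^ (n + 1) - 1) atTop atTop := by
    refine tendsto_atTop_mono (f := fun n : ℕ => (n : ℚ)) (fun n => ?_) tendsto_natCast_atTop_atTop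
    have := cast_le_card_pow (F := F) (n + 1)
    push_cast at this
    linarith
  obtain ⟨N, hN1, hN2⟩ := ((hq.eventually_ge_atTop r).and (tendsto_iff_ball.mp h r)).exists
  filter_upwards [eventually_ge_atTop (Finset.range N)] with t ht
  have h1 : ∏ i ∈ Finset.range N, periodFactor F s i ∈ ball F s 0 := by
    have h2 := prod_periodFactor_sub_one_mem_ball (F := F) (s := s) (t := Finset.range N) (N := 0)
      fun i _ => i.zero_le
    have h3 := add_mem (ball_anti (sub_pos.mpr (one_lt_card_pow_succ 0)).le h2) one_mem_ball
    rwa [sub_add_cancel] at h3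
  have h2 : ∏ i ∈ t \ Finset.range N, periodFactor F s i - 1 ∈ ball F s r :=
    ball_anti hN1 (prod_periodFactor_sub_one_mem_ball fun i hi => by
      simpa using (Finset.mem_sdiff.mp hi).2)
  have h3 := mul_mem_ball h2 h1
  rw [add_zero, sub_mul, one_mul, Finset.prod_sdiff ht] at h3
  have h4 := add_mem h3 hN2
  rwa [sub_add_sub_cancel] at h4

variable {ρ : KK F s}

theorem root_ne_zero (hρ : ρ ^ (q - 1) = -theta F s) : ρ ≠ 0 := by
  rintro rfl
  rw [zero_pow (Nat.sub_ne_zero_of_lt Fintype.one_lt_card)] at hρ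
  exact neg_ne_zero.mpr theta_ne_zero hρ.symm

theorem vInf_root (hρ : ρ ^ (q - 1) = -theta F s) : vInf F s ρ = (1 - β : ℚ) := by
  obtain ⟨a, ha⟩ := exists_vInf_eq (root_ne_zero hρ)
  have h := vInf_pow ha (q - 1)
  rw [hρ, vInf_neg, vInf_theta, Nat.cast_sub Fintype.card_pos, Nat.cast_one] at h
  have h1 : (-1 : ℚ) = (q - 1) * a := WithTop.coe_injective h
  rw [ha]
  congr 1
  have h2 : (q : ℚ) - 1 ≠ 0 := (sub_pos.mpr one_lt_card_rat).ne'
  rw [convExp]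
  field_simp
  linarith

/-- The terms of the logarithm of `ρ = (-θ)^{1/(q-1)}`. -/
theorem logTerm_root (hρ : ρ ^ (q - 1) = -theta F s) (n : ℕ) :
    logTerm ρ n = ρ * (theta F s / theta F s ^ q ^ n) *
      ∏ i ∈ Finset.range n, periodFactor F s i := by
  have hθ : ∀ m, theta F s ^ m ≠ 0 := fun m => pow_ne_zero m theta_ne_zero
  induction n with
  | zero => simp [logTerm, carlitzL, theta_ne_zero]
  | succ n ih =>
    have h1 : logTerm ρ (n + 1) = logTerm ρ n * (-theta F s ^ q ^ n /
        (theta F s - theta F s ^ q ^ (n + 1))) := by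
      rw [logTerm, logTerm, Function.iterate_succ_apply, tau_root hρ, iterate_map_mul,
        iterate_map_neg, tau_iterate_theta, carlitzL, Finset.prod_range_succ, mul_inv, ← carlitzL]
      ring
    have h2 := theta_sub_ne_zero (F := F) (s := s) n
    have h3 := hθ (q ^ (n + 1))
    have h4 : theta F s ^ q ^ (n + 1) - theta F s ≠ 0 := by rwa [← neg_ne_zero, neg_sub]
    have h5 := hθ (q ^ n)
    have h6 : periodFactor F s n =
        theta F s ^ q ^ (n + 1) / (theta F s ^ q ^ (n + 1) - theta F s) := by
      rw [periodFactor_eq, one_sub_div h3, inv_div]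
    have h7 : -theta F s ^ q ^ n / (theta F s - theta F s ^ q ^ (n + 1)) =
        theta F s ^ q ^ n / (theta F s ^ q ^ (n + 1) - theta F s) := by
      rw [← neg_div_neg_eq, neg_neg, neg_sub]
    rw [h1, ih, Finset.prod_range_succ, h6, h7]
    field_simp

/-- The series `log_C(ρ)` is telescoping: its partial sums are the partial products of the
period, multiplied by `ρ`. -/
theorem sum_logTerm_root (hρ : ρ ^ (q - 1) = -theta F s) (n : ℕ) :
    ∑ j ∈ Finset.range (n + 1), logTerm ρ j = ρ * ∏ i ∈ Finset.range n, periodFactor F s i := by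
  induction n with
  | zero => simp [logTerm, carlitzL]
  | succ n ih =>
    rw [Finset.sum_range_succ, ih, logTerm_root hρ, Finset.prod_range_succ]
    have h : periodFactor F s n * (1 - theta F s / theta F s ^ q ^ (n + 1)) = 1 := by
      rw [periodFactor_eq, inv_mul_cancel₀ (one_sub_theta_div_ne_zero n)]
    linear_combination (-ρ * ∏ i ∈ Finset.range n, periodFactor F s i) * h

theorem hasProd_period (hρ : ρ ^ (q - 1) = -theta F s) :
    HasProd (periodFactor F s) (ρ⁻¹ * ∑' n, logTerm ρ n) := by
  refine hasProd_periodFactor ?_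
  have h := (summable_logTerm (mem_ball_self (vInf_root hρ)) (by linarith)).hasSum
  have h1 := ((h.tendsto_sum_nat.comp (tendsto_add_atTop_nat 1)).const_mul ρ⁻¹)
  refine h1.congr fun n => ?_
  rw [Function.comp_apply, sum_logTerm_root hρ, inv_mul_cancel_left₀ (root_ne_zero hρ)]

theorem period_eq (hρ : ρ ^ (q - 1) = -theta F s) :
    period F s ρ = theta F s * ∑' n, logTerm ρ n := by
  rw [period, (hasProd_period hρ).tprod_eq]
  have h : ρ ^ q = -theta F s * ρ := by
    rw [← hρ, ← pow_succ, Nat.sub_add_cancel Fintype.card_pos]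
  rw [h]
  have := root_ne_zero hρ
  field_simp

/-- The quotient `π̃ / θ` is the logarithm of `ρ`. -/
theorem expC_period_div (hρ : ρ ^ (q - 1) = -theta F s) :
    expC F s (period F s ρ / theta F s) = ρ := by
  rw [period_eq hρ, mul_div_cancel_left₀ _ theta_ne_zero]
  exact expC_tsum_logTerm (mem_ball_self (vInf_root hρ)) (by linarith)

theorem expC_period (hρ : ρ ^ (q - 1) = -theta F s) : expC F s (period F s ρ) = 0 := by
  have h := expC_theta_mul (period F s ρ / theta F s)
  rw [mul_div_cancel₀ _ theta_ne_zero, expC_period_div hρ, tau_root hρ] at h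
  rw [h]
  ring

end

/-! ### The operator `1 - τ` of `𝕂_s` -/

section

open Filter Topology

variable {F : Type u} [Field F] {s : ℕ}

theorem coeffHom_ne_zero_of_vInf_eq {x : KK F s} {r : ℚ} (hx : vInf F s x = r) :
    coeffHom F s r x ≠ 0 := by
  have h : HahnSeries.orderTop (x : HahnSeries ℚ (CoeffField F s)) = r :=
    HahnSeries.addVal_apply.symm.trans hx
  exact HahnSeries.coeff_orderTop_ne h

theorem coeffHom_const (c : CoeffField F s) (i : ℚ) :
    coeffHom F s i (const F s c) = if i = 0 then c else 0 := by
  split_ifs with h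
  · subst h; exact HahnSeries.coeff_single_same _ _
  · exact HahnSeries.coeff_single_of_ne h

/-- The part of a series supported by the exponents in a set. -/
def restrictTo (P : Set ℚ) (u : KK F s) : KK F s := by
  classical
  exact (⟨P.indicator (u : HahnSeries ℚ (CoeffField F s)).coeff,
    (HahnSeries.isPWO_support (u : HahnSeries ℚ (CoeffField F s))).mono fun i hi => by
      intro h0
      refine hi ?_
      rw [Set.indicator_apply_eq_zero]
      exact fun _ => h0⟩ : HahnSeries ℚ (CoeffField F s))

open Classical in
theorem coeffHom_restrictTo (P : Set ℚ) (u : KK F s) (i : ℚ) :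
    coeffHom F s i (restrictTo P u) = if i ∈ P then coeffHom F s i u else 0 := rfl

theorem smul_mem_ball {r : ℚ} {f : KK F s} (hf : f ∈ ball F s r) (b : BaseField F s) :
    b • f ∈ ball F s r := by
  have hc : const F s (baseEmb F s b) ∈ ball F s 0 :=
    mem_ball_iff_coeff.mpr fun i hi => by rw [coeffHom_const, if_neg hi.ne]
  have h := mul_mem_ball hc hf
  rwa [zero_add] at h

variable [Fintype F]

local notation "q" => Fintype.card F

/-- The elements of `𝕂_s` fixed by `τ` are constants: an element with nonzero valuation `r` is not
fixed, since `τ` multiplies valuations by `q`. -/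
theorem exists_const_eq_of_tau_eq {h : KK F s} (hh : tau F s h = h) :
    ∃ b : BaseField F s, h = const F s (baseEmb F s b) := by
  have h0 : coeffTwist F s (coeffHom F s 0 h) = coeffHom F s 0 h := by
    have := coeffHom_tau h 0
    rwa [hh, zero_div, eq_comm] at this
  obtain ⟨b, hb⟩ := exists_baseEmb_eq_of_coeffTwist_eq F s h0
  refine ⟨b, ?_⟩
  rw [hb]
  by_contra hne
  obtain ⟨r, hr⟩ := exists_vInf_eq (sub_ne_zero.mpr hne)
  have hfix : tau F s (h - const F s (coeffHom F s 0 h)) = h - const F s (coeffHom F s 0 h) := by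
    rw [map_sub, hh, tau_const, h0]
  have h1 : q * r ≤ r := by
    rw [← mem_ball_iff_le hr, ← hfix, tau_mem_ball_iff]
    exact mem_ball_self hr
  have h2 : r / q ≤ r := by
    rw [← mem_ball_iff_le hr, ← tau_mem_ball_iff, hfix, mul_div_cancel₀ _ card_pos_rat.ne']
    exact mem_ball_self hr
  have hq := one_lt_card_rat (F := F)
  rw [div_le_iff₀ card_pos_rat] at h2
  have hr0 : r = 0 := by nlinarith
  subst hr0
  refine coeffHom_ne_zero_of_vInf_eq hr ?_
  rw [map_sub, coeffHom_const, if_pos rfl, sub_self]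

/-- If all exponents of `u` are positive, then the series `∑_{n ≥ 0} τⁿ(u)` converges and solves
`h - τ(h) = u`. -/
theorem exists_sub_tau_of_mem_ball {u : KK F s} {m : ℚ} (hm : 0 < m) (hu : u ∈ ball F s m) :
    ∃ h, h - tau F s h = u := by
  have hsum : Summable fun n => (tau F s)^[n] u := by
    refine summable_nat_of_mem_ball ?_ (tau_iterate_mem_ball hu)
    exact (tendsto_pow_atTop_atTop_of_one_lt one_lt_card_rat).atTop_mul_const hm
  refine ⟨∑' n, (tau F s)^[n] u, ?_⟩
  have h1 : tau F s (∑' n, (tau F s)^[n] u) = ∑' n, tau F s ((tau F s)^[n] u) :=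
    hsum.map_tsum _ continuous_tau
  rw [h1, hsum.tsum_eq_zero_add]
  simp only [Function.iterate_succ_apply', Function.iterate_zero_apply, add_sub_cancel_right]

/-- The coefficient of `θ^{-i}` in `τ^{-n}(u)`. -/
def untwistCoeff (u : KK F s) (n : ℕ) (i : ℚ) : CoeffField F s :=
  (coeffTwistEquiv F s).symm^[n] (coeffHom F s (q ^ n * i) u)

theorem untwistCoeff_ne_zero {u : KK F s} {n : ℕ} {i : ℚ} (h : untwistCoeff u n i ≠ 0) :
    coeffHom F s (q ^ n * i) u ≠ 0 := by
  intro h0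
  rw [untwistCoeff, h0, iterate_map_zero] at h
  exact h rfl

theorem coeffTwist_untwistCoeff_succ (u : KK F s) (n : ℕ) (i : ℚ) :
    coeffTwist F s (untwistCoeff u (n + 1) (i / q)) = untwistCoeff u n i := by
  rw [untwistCoeff, untwistCoeff, Function.iterate_succ_apply', ← coeffTwistEquiv_apply,
    RingEquiv.apply_symm_apply, pow_succ, mul_assoc, mul_div_cancel₀ _ card_pos_rat.ne']

/-- If all exponents of `u` are negative, then a solution of `h - τ(h) = u` is
`-∑_{n ≥ 1} τ^{-n}(u)`. That family does not converge for the valuation, but each exponent occurs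
in finitely many of its members, and the union of their supports is well-ordered: an initial segment
of it with negative upper bound only involves finitely many `n`. -/
theorem exists_sub_tau_of_neg {u : KK F s} (hu : ∀ i, 0 ≤ i → coeffHom F s i u = 0) :
    ∃ h, h - tau F s h = u := by
  obtain ⟨M, hM⟩ := exists_mem_ball u
  have hneg : ∀ {n i}, untwistCoeff u n i ≠ 0 → i < 0 := by
    intro n i h
    by_contra hi
    exact untwistCoeff_ne_zero h (hu _ (mul_nonneg (by positivity) (not_lt.mp hi)))
  have hbound : ∀ {n i r}, untwistCoeff u n i ≠ 0 → i ≤ r → r < 0 → (n : ℚ) ≤ M / r := by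
    intro n i r h hir hr
    have h1 : M ≤ q ^ n * i := by
      by_contra hlt
      exact untwistCoeff_ne_zero h (mem_ball_iff_coeff.mp hM _ (not_le.mp hlt))
    rw [le_div_iff_of_neg hr]
    have h2 := cast_le_card_pow (F := F) n
    nlinarith [one_le_card_pow (F := F) n]
  have hfin : ∀ i, ∃ N, ∀ n, N ≤ n → untwistCoeff u n i = 0 := by
    intro i
    obtain ⟨N, hN⟩ := exists_nat_gt (M / i)
    refine ⟨N, fun n hn => ?_⟩
    by_contra h
    have h1 := hbound h le_rfl (hneg h)
    have h2 : (N : ℚ) ≤ n := by exact_mod_cast hn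
    linarith
  let c : ℚ → CoeffField F s := fun i => -∑ᶠ n, untwistCoeff u (n + 1) i
  have hc : ∀ i N, (∀ n, N ≤ n → untwistCoeff u (n + 1) i = 0) →
      c i = -∑ n ∈ Finset.range N, untwistCoeff u (n + 1) i := by
    intro i N hN
    refine congrArg _ (finsum_eq_sum_of_support_subset _ fun n hn => ?_)
    rw [Finset.mem_coe, Finset.mem_range]
    by_contra hlt
    exact hn (hN n (not_lt.mp hlt))
  have hmem : ∀ {i}, c i ≠ 0 → ∃ n, untwistCoeff u (n + 1) i ≠ 0 := by
    intro i hi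
    by_contra! h
    exact hi (by rw [hc i 0 fun n _ => h n]; simp)
  have hpwo : (Function.support c).IsPWO := by
    refine isPWO_of_forall_inter_Iic fun r hr => ?_
    have hr0 : r < 0 := hneg (hmem hr).choose_spec
    obtain ⟨N, hN⟩ := exists_nat_gt (M / r)
    refine Set.IsPWO.mono (t := ⋃ n ∈ Finset.range N,
      (fun i : ℚ => i / q ^ n) '' HahnSeries.support (u : HahnSeries ℚ (CoeffField F s))) ?_ ?_
    · refine (Finset.isPWO_bUnion _).mpr fun n _ => ?_
      refine (HahnSeries.isPWO_support _).image_of_monotone fun a b hab => ?_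
      exact div_le_div_of_nonneg_right hab (by positivity)
    · rintro i ⟨hi, hir⟩
      obtain ⟨n, hn⟩ := hmem hi
      refine Set.mem_biUnion (x := n + 1) ?_ ⟨q ^ (n + 1) * i, untwistCoeff_ne_zero hn, ?_⟩
      · rw [Finset.mem_coe, Finset.mem_range]
        have h1 := (hbound hn hir hr0).trans_lt hN
        exact_mod_cast h1
      · exact mul_div_cancel_left₀ _ (pow_ne_zero _ card_pos_rat.ne')
  let h : KK F s := (⟨c, hpwo⟩ : HahnSeries ℚ (CoeffField F s))
  refine ⟨h, KK.ext fun i => ?_⟩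
  obtain ⟨N, hN⟩ := hfin i
  have h1 : coeffHom F s i h = -∑ n ∈ Finset.range N, untwistCoeff u (n + 1) i :=
    hc i N fun n hn => hN _ (hn.trans n.le_succ)
  have h2 : coeffHom F s (i / q) h =
      -∑ n ∈ Finset.range (N + 1), untwistCoeff u (n + 1) (i / q) := by
    refine hc _ _ fun n hn => ?_
    rw [← map_eq_zero (coeffTwist F s), coeffTwist_untwistCoeff_succ]
    exact hN n (N.le_succ.trans hn)
  rw [map_sub, coeffHom_tau, h1, h2, map_neg, map_sum]
  simp only [coeffTwist_untwistCoeff_succ]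
  rw [Finset.sum_range_succ', sub_neg_eq_add, neg_add_cancel_left]
  simp [untwistCoeff]

/-- The operator `1 - τ` is surjective: the negative, zero and positive exponents are treated
separately. -/
theorem exists_sub_tau (u : KK F s) : ∃ h, h - tau F s h = u := by
  obtain ⟨h1, e1⟩ := exists_sub_tau_of_neg (u := restrictTo (Set.Iio 0) u) fun i hi => by
    rw [coeffHom_restrictTo, if_neg (by simpa using hi)]
  obtain ⟨x, hx⟩ := exists_sub_coeffTwist F s (coeffHom F s 0 u)
  obtain ⟨h3, e3⟩ : ∃ h, h - tau F s h = restrictTo (Set.Ioi 0) u := by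
    by_cases h0 : restrictTo (Set.Ioi 0) u = 0
    · exact ⟨0, by rw [h0, map_zero, sub_zero]⟩
    · obtain ⟨m, hm⟩ := exists_vInf_eq h0
      refine exists_sub_tau_of_mem_ball ?_ (mem_ball_self hm)
      have := coeffHom_ne_zero_of_vInf_eq hm
      rw [coeffHom_restrictTo] at this
      by_contra hm0
      exact this (if_neg hm0)
  refine ⟨h1 + const F s x + h3, ?_⟩
  have h2 : const F s x - tau F s (const F s x) = const F s (coeffHom F s 0 u) := by
    rw [tau_const, ← map_sub, hx]
  have hsplit : u = restrictTo (Set.Iio 0) u + const F s (coeffHom F s 0 u) +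
      restrictTo (Set.Ioi 0) u := by
    refine KK.ext fun i => ?_
    rw [map_add, map_add, coeffHom_restrictTo, coeffHom_restrictTo, coeffHom_const]
    rcases lt_trichotomy i 0 with hi | rfl | hi
    · simp [hi, hi.ne, hi.le]
    · simp
    · simp [hi, hi.ne', hi.le]
  rw [map_add, map_add]
  conv_rhs => rw [hsplit, ← e1, ← h2, ← e3]
  ring

/-! ### The kernel and the image of the exponential -/

local notation "β" => convExp F

variable {ρ : KK F s}

theorem exists_theta_mul_add_tau (g : KK F s) : ∃ f, theta F s * f + tau F s f = g := by
  obtain ⟨ρ, hρ⟩ := exists_root F s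
  have h0 := root_ne_zero hρ
  have h1 := theta_ne_zero (F := F) (s := s)
  obtain ⟨h, hh⟩ := exists_sub_tau (g / (theta F s * ρ))
  refine ⟨ρ * h, ?_⟩
  rw [eq_div_iff (mul_ne_zero h1 h0)] at hh
  rw [map_mul, tau_root hρ, ← hh]
  ring

theorem exists_smul_eq_of_theta_mul_add_tau_eq_zero (hρ : ρ ^ (q - 1) = -theta F s) {f : KK F s}
    (hf : theta F s * f + tau F s f = 0) : ∃ b : BaseField F s, f = b • ρ := by
  have h0 := root_ne_zero hρ
  have h1 := theta_ne_zero (F := F) (s := s)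
  obtain ⟨b, hb⟩ := exists_const_eq_of_tau_eq (h := f / ρ) (by
    rw [map_div₀, tau_root hρ, eq_neg_of_add_eq_zero_right hf]
    field_simp)
  refine ⟨b, ?_⟩
  rw [Algebra.smul_def, ← div_eq_iff h0, hb]
  rfl

/-- The division by `θ` for the Carlitz action divides very negative valuations by `q`. -/
theorem mem_ball_of_theta_mul_add_tau {f : KK F s} {n : ℕ}
    (h : theta F s * f + tau F s f ∈ ball F s (-(q : ℚ) ^ (n + 1))) :
    f ∈ ball F s (-(q : ℚ) ^ n) := by
  rcases eq_or_ne f 0 with rfl | hf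
  · exact zero_mem _
  obtain ⟨r, hr⟩ := exists_vInf_eq hf
  rw [mem_ball_iff_le hr]
  by_contra hlt
  rw [not_le] at hlt
  have hq := one_lt_card_rat (F := F)
  have hq2 : (2 : ℚ) ≤ q := by exact_mod_cast (Fintype.one_lt_card (α := F))
  have hn := one_le_card_pow (F := F) n
  -- as `r < -q^n ≤ -1`, the valuation `q r` of `τ(f)` is less than the valuation of `θ f`
  have h1 : theta F s * f ∈ ball F s (-1 + r) := mem_ball_self (vInf_mul vInf_theta hr)
  have h2 : tau F s f ∈ ball F s (min (-1 + r) (-(q : ℚ) ^ (n + 1))) := by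
    have := sub_mem (ball_anti (min_le_right (-1 + r) _) h) (ball_anti (min_le_left _ _) h1)
    rwa [add_sub_cancel_left] at this
  have h3 : f ∈ ball F s (min (-1 + r) (-(q : ℚ) ^ (n + 1)) / q) := by
    rwa [← tau_mem_ball_iff, mul_div_cancel₀ _ card_pos_rat.ne']
  rw [mem_ball_iff_le hr, div_le_iff₀ card_pos_rat, min_le_iff] at h3
  rcases h3 with h3 | h3
  · nlinarith
  · rw [pow_succ] at h3
    nlinarith

theorem neg_convExp_lt_neg_one : -β < -1 := neg_lt_neg one_lt_convExp

theorem expC_surjective : Function.Surjective (expC F s) := by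
  have key : ∀ n : ℕ, ∀ g ∈ ball F s (-(q : ℚ) ^ n), ∃ f, expC F s f = g := by
    intro n
    induction n with
    | zero =>
      intro g hg
      rw [pow_zero] at hg
      exact ⟨_, expC_tsum_logTerm hg neg_convExp_lt_neg_one⟩
    | succ n ih =>
      intro g hg
      obtain ⟨f, rfl⟩ := exists_theta_mul_add_tau g
      obtain ⟨f', rfl⟩ := ih f (mem_ball_of_theta_mul_add_tau hg)
      exact ⟨theta F s * f', expC_theta_mul f'⟩
  intro g
  obtain ⟨r, hr⟩ := exists_mem_ball g
  obtain ⟨n, hn⟩ := exists_nat_gt (-r)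
  refine key n g (ball_anti ?_ hr)
  have := cast_le_card_pow (F := F) n
  linarith

theorem period_div_theta_mem_ball (hρ : ρ ^ (q - 1) = -theta F s) :
    period F s ρ / theta F s ∈ ball F s (-1) := by
  rw [period_eq hρ, mul_div_cancel_left₀ _ theta_ne_zero]
  refine tsum_mem_ball fun n => ball_anti ?_ (logTerm_mem_ball (mem_ball_self (vInf_root hρ)) n)
  have h1 := one_le_card_pow (F := F) n
  have h2 := convExp_le_two (F := F)
  rw [sub_add_cancel, mul_one]
  linarith

/-- The kernel of the exponential is generated by the period. The induction is on a lower bound for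
the valuation. -/
theorem mem_span_period_of_expC_eq_zero (hρ : ρ ^ (q - 1) = -theta F s) {f : KK F s}
    (hf : expC F s f = 0) : f ∈ Submodule.span (BaseField F s)[X] {period F s ρ} := by
  have key : ∀ n : ℕ, ∀ f ∈ ball F s (-1 - n), expC F s f = 0 →
      f ∈ Submodule.span (BaseField F s)[X] {period F s ρ} := by
    intro n
    induction n with
    | zero =>
      intro f hf h0
      rw [Nat.cast_zero, sub_zero] at hf
      rw [eq_zero_of_expC_eq_zero hf neg_convExp_lt_neg_one h0]
      exact zero_mem _
    | succ n ih =>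
      intro f hf h0
      have hθ := theta_ne_zero (F := F) (s := s)
      have h1 : theta F s * expC F s (f / theta F s) + tau F s (expC F s (f / theta F s)) = 0 := by
        rw [← expC_theta_mul, mul_div_cancel₀ _ hθ, h0]
      obtain ⟨b, hb⟩ := exists_smul_eq_of_theta_mul_add_tau_eq_zero hρ h1
      -- the element `f' = (f - b π̃) / θ` is in the kernel too
      have hf' : f / theta F s + (-b) • (period F s ρ / theta F s) ∈ ball F s (-1 - n) := by
        refine add_mem ?_ (ball_anti ?_ (smul_mem_ball (period_div_theta_mem_ball hρ) (-b)))
        · have := mul_mem_ball hf (mem_ball_self (vInf_inv (vInf_theta (F := F) (s := s))))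
          rw [← div_eq_mul_inv] at this
          refine ball_anti (le_of_eq ?_) this
          push_cast
          ring
        · have : (0 : ℚ) ≤ n := n.cast_nonneg
          linarith
      have h2 := ih _ hf' (by
        rw [expC_add, expC_smul, expC_period_div hρ, hb, neg_smul, add_neg_cancel])
      have h3 : f = (X : (BaseField F s)[X]) •
          (f / theta F s + (-b) • (period F s ρ / theta F s)) +
          (C b : (BaseField F s)[X]) • period F s ρ := by
        rw [X_smul, C_smul, mul_add, mul_div_cancel₀ _ hθ, mul_smul_comm, mul_div_cancel₀ _ hθ,
          neg_smul, neg_add_cancel_right]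
      rw [h3]
      exact add_mem (Submodule.smul_mem _ _ h2)
        (Submodule.smul_mem _ _ (Submodule.mem_span_singleton_self _))
  obtain ⟨r, hr⟩ := exists_mem_ball f
  obtain ⟨n, hn⟩ := exists_nat_gt (-r)
  exact key n f (ball_anti (by linarith) hr) hf

end

end

end Carlitz


open Carlitz Polynomial in
theorem proposition3p2 (F : Type*) [Field F] [Fintype F] (s : ℕ)
    (ρ : KK F s) (hρ : ρ ^ (Fintype.card F - 1) = -theta F s) :
    Multipliable (periodFactor F s) ∧
    (∀ f : KK F s, Summable (expTerm F s f)) ∧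
    ∃ E : KK F s →ₗ[(BaseField F s)[X]] CKK F s,
      (∀ f : KK F s, E f = toCKK F s (expC F s f)) ∧
      Function.Injective (Submodule.span (BaseField F s)[X] {period F s ρ}).subtype ∧
      Function.Exact (Submodule.span (BaseField F s)[X] {period F s ρ}).subtype E ∧
      Function.Surjective E := by
  refine ⟨⟨_, hasProd_period hρ⟩, summable_expTerm, expLin F s, expLin_apply,
    Submodule.subtype_injective _, fun f => ?_,
    (toCKK F s).surjective.comp expC_surjective⟩
  rw [expLin_apply, EmbeddingLike.map_eq_zero_iff,
    Submodule.coe_subtype, Subtype.range_coe, SetLike.mem_coe]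
  refine ⟨mem_span_period_of_expC_eq_zero hρ, fun hf => ?_⟩
  obtain ⟨p, rfl⟩ := Submodule.mem_span_singleton.mp hf
  have h : expLin F s (p • period F s ρ) = 0 := by
    rw [map_smul, expLin_apply, expC_period hρ, map_zero, smul_zero]
  rwa [expLin_apply, EmbeddingLike.map_eq_zero_iff] at h
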